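/- Let $d\ge 2$ be an integer, $s>\tfrac12$ and $\tfrac d2<\alpha<d-\tfrac12$. For a function $u$ on $\mathbb R^d$ that is a tempered distribution whose Fourier transform $\widehat u$ (with kernel $e^{-2\pi i x\cdot\xi}$) is a locally integrable function, define $D^s u$ by $\widehat{D^s u}(\xi)=|\xi|^s\,\widehat u(\xi)$, and write $u\in\dot H^s(\mathbb R^d)$ if $D^su\in L^2(\mathbb R^d)$. Put $\left(|x|^{-\alpha}\star|u|\right)(x)=\int_{\mathbb R^d}|x-y|^{-\alpha}|u(y)|\,dy$ and let $$X=\Big\{u\in\dot H^s(\mathbb R^d)\ :\ u \text{ is radially symmetric and } \big\|\,|x|^{-\alpha}\star|u|\,\big\|_{L^2(\mathbb R^d)}<\infty\Big\}.$$ Set $$p_{rad}=\frac{2\left(\alpha-\frac d2\right)+2s(d-1)}{-(2s-1)\left(\alpha-\frac d2\right)+2s(d-1)} .$$ Then $p_{rad}<2$. Moreover, for every real $p$ with $$p\in\Big(p_{rad},\tfrac{2d}{d-2s}\Big]\ \text{ if } s<\tfrac d2,\qquad p\in(p_{rad},\infty)\ \text{ if } s\ge\tfrac d2,$$ every $u\in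 X$ belongs to $L^p(\mathbb R^d)$, and there is a constant $C=C(\alpha,s,p,d)$ such that for all $u\in X$ $$\|u\|_{L^p(\mathbb R^d)}\le C\,\big\|\,|x|^{-\alpha}\star|u|\,\big\|_{L^2(\mathbb R^d)}^{1-\theta}\,\|D^su\|_{L^2(\mathbb R^d)}^{\theta},$$ where $\theta$ is the real number fixed by the scaling relation $$\frac dp=(1-\theta)\Big((d-\alpha)+\frac d2\Big)+\theta\Big(-s+\frac d2\Big).$$ -/

import Mathlib

open MeasureTheory
open scoped SchwartzMap FourierTransform ENNReal NNReal

noncomputable section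

/-- Euclidean space `ℝ^d`. -/
abbrev Space (d : ℕ) : Type := EuclideanSpace ℝ (Fin d)

/-- The tempered distribution `T` is (given by) the locally integrable function `f`:
`T φ = ∫ φ f` for every Schwartz function `φ`, the integral being absolutely convergent. -/
structure IsGivenBy {d : ℕ} (T : 𝓢'(Space d, ℂ)) (f : Space d → ℂ) : Prop where
  locallyIntegrable : LocallyIntegrable f
  integrable : ∀ φ : 𝓢(Space d, ℂ), Integrable (fun x => φ x * f x)
  apply_eq : ∀ φ : 𝓢(Space d, ℂ), T φ = ∫ x, φ x * f x

/-- `v = D^s u`: the functions `u` and `v` are tempered distributions, the Fourier transform of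
`u` is a locally integrable function `g`, and the Fourier transform of `v` is the function
`ξ ↦ |ξ|^s g ξ`. (The Fourier transform is the one with kernel `exp (-2 π i x·ξ)`.) -/
def IsFracDeriv {d : ℕ} (s : ℝ) (u v : Space d → ℂ) : Prop :=
  ∃ (U V : 𝓢'(Space d, ℂ)) (g : Space d → ℂ),
    IsGivenBy U u ∧ IsGivenBy V v ∧ IsGivenBy (𝓕 U) g ∧
      IsGivenBy (𝓕 V) (fun ξ => ((‖ξ‖ ^ s : ℝ) : ℂ) * g ξ)

/-- `u` belongs to the homogeneous Sobolev space of order `s`: its Fourier transform is a locally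
integrable function and `D^s u` is in `L²`. -/
def MemHomSobolev {d : ℕ} (s : ℝ) (u : Space d → ℂ) : Prop :=
  ∃ v : Space d → ℂ, IsFracDeriv s u v ∧ MemLp v 2

/-- `u` is radially symmetric: it agrees almost everywhere with a function of `|x|`. -/
def IsRadial {d : ℕ} (u : Space d → ℂ) : Prop :=
  ∃ f : ℝ → ℂ, u =ᵐ[volume] fun x => f ‖x‖

/-- The convolution `(|x|^{-α} ⋆ |u|)(x) = ∫ |u(y)| / |x - y|^α dy`, with values in `[0, ∞]`. -/
def rieszConv {d : ℕ} (α : ℝ) (u : Space d → ℂ) (x : Space d) : ℝ≥0∞ :=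
  ∫⁻ y, ‖u y‖ₑ * ‖x - y‖ₑ ^ (-α)

/-- The space `X_{s,α,d}` of the radial `u` in the homogeneous Sobolev space of order `s` for which
`|x|^{-α} ⋆ |u|` has finite `L²` norm. -/
structure MemX {d : ℕ} (s α : ℝ) (u : Space d → ℂ) : Prop where
  memHomSobolev : MemHomSobolev s u
  isRadial : IsRadial u
  riesz_lt_top : eLpNorm (rieszConv α u) 2 volume < ∞

/-- The lower endpoint exponent. -/
def pRad (d : ℕ) (s α : ℝ) : ℝ :=
  (2 * (α - d / 2) + 2 * s * (d - 1)) / (-(2 * s - 1) * (α - d / 2) + 2 * s * (d - 1))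

end

/-! ### Frequency splitting and Plancherel for tempered distributions given by functions -/

section FourierSplitting

variable {d : ℕ}

/-! Cut `u` smoothly at frequency `M`, and let `a`, `b` bound the two norms on the right. By
Plancherel the high part has `L²` norm at most `M ^ (-s) * b`. The low part is an average of `u` at
scale `1 / M`, so a pointwise bound for it controls how large `|u|` can be outside a set measured by
the high part.

For `p > 2`, a growth bound `Λ * M ^ σ` on the low part gives `L^(2 + 2s/σ)`: in the layer cake
formula the cutoff is chosen at each level `t` so that the low part is at most `t / 2`
(`RadialBounds.lintegral_rpow_le_of_lowFreq_le`). Cauchy–Schwarz in frequency gives `σ = d/2 - s`,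
the Sobolev endpoint. If `s ≥ d/2`, the Riesz bound `σ = 3d/2 - α` starts an iteration in which an
`L^q` bound is fed back through Hölder with `σ = d/q`, and arbitrarily large exponents are reached.

For `pRad < p ≤ 2`, radial symmetry enters. The Riesz norm controls the `L¹` mass of `u` on balls,
with growth `R ^ (α - d/2)`. A convolution of a radial function with a radial kernel is constant on
spheres, so averaging over a shell of radius `R` and thickness `1 / M` bounds the low part by `a * M
* R ^ (α - d/2 - d + 1)` (`lintegral_radial_mul_decayKer_le_riesz`). On each dyadic shell, mass and
high frequencies are balanced by the choice of cutoff and the contributions form a geometric series,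
convergent exactly when `p > pRad` (`radialIneq_of_pRad_lt`). Since `pRad < 2`, this includes `L²`,
and Hölder interpolation with the large exponents fills the rest of the range. -/

theorem ae_eq_of_forall_integral_schwartz_eq {f f' : Space d → ℂ} (hf : LocallyIntegrable f)
    (hf' : LocallyIntegrable f')
    (h : ∀ φ : 𝓢(Space d, ℂ), ∫ x, φ x * f x = ∫ x, φ x * f' x) : f =ᵐ[volume] f' := by
  refine ae_eq_of_integral_contDiff_smul_eq hf hf' fun g g_smooth g_cpt => ?_
  have hg₁ : HasCompactSupport (Complex.ofRealCLM ∘ g) := g_cpt.comp_left rfl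
  have hg₂ : ContDiff ℝ (⊤ : ℕ∞) (Complex.ofRealCLM ∘ g) := by fun_prop
  simpa using! h (hg₁.toSchwartzMap hg₂)

theorem IsGivenBy.ae_eq {T : 𝓢'(Space d, ℂ)} {f f' : Space d → ℂ} (h : IsGivenBy T f)
    (h' : IsGivenBy T f') : f =ᵐ[volume] f' :=
  ae_eq_of_forall_integral_schwartz_eq h.locallyIntegrable h'.locallyIntegrable
    fun φ => (h.apply_eq φ).symm.trans (h'.apply_eq φ)

/-- The `L²` inverse Fourier transform of `G` has the same pairings with Schwartz functions as `f`,
so the two agree almost everywhere and the `L²` isometry applies. -/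
theorem memLp_two_of_integral_fourierInv_eq {f G : Space d → ℂ} (hf : LocallyIntegrable f)
    (hG : MemLp G 2)
    (h : ∀ φ : 𝓢(Space d, ℂ), ∫ x, φ x * f x = ∫ ξ, (𝓕⁻ φ) ξ * G ξ) :
    MemLp f 2 ∧ eLpNorm f 2 = eLpNorm G 2 := by
  set W : Lp ℂ 2 (volume : Measure (Space d)) := 𝓕⁻ (hG.toLp G) with hW
  have hWf : f =ᵐ[volume] W := by
    refine ae_eq_of_forall_integral_schwartz_eq hf
      ((Lp.memLp W).locallyIntegrable (by norm_num)) fun φ => ?_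
    have h1 := DFunLike.congr_fun (Lp.fourierInv_toTemperedDistribution_eq (hG.toLp G)) φ
    rw [TemperedDistribution.fourierInv_apply, Lp.toTemperedDistribution_apply,
      Lp.toTemperedDistribution_apply] at h1
    rw [h φ]
    simp only [smul_eq_mul] at h1
    rw [← hW] at h1
    rw [← h1]
    refine integral_congr_ae ?_
    filter_upwards [hG.coeFn_toLp] with x hx
    rw [hx]
  refine ⟨(memLp_congr_ae hWf).2 (Lp.memLp W), ?_⟩
  rw [eLpNorm_congr_ae hWf, ← eLpNorm_congr_ae hG.coeFn_toLp, ← Lp.enorm_def, ← Lp.enorm_def]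
  have : ‖W‖ = ‖hG.toLp G‖ := by
    rw [← Lp.norm_fourier_eq W, hW, FourierTransform.fourier_fourierInv_eq]
  rw [← ofReal_norm, ← ofReal_norm, this]

theorem memLp_two_of_integral_fourier_eq {f G : Space d → ℂ} (hf : LocallyIntegrable f)
    (hG : MemLp G 2)
    (h : ∀ φ : 𝓢(Space d, ℂ), ∫ x, φ x * f x = ∫ ξ, (𝓕 φ) ξ * G ξ) :
    MemLp f 2 ∧ eLpNorm f 2 = eLpNorm G 2 := by
  set W : Lp ℂ 2 (volume : Measure (Space d)) := 𝓕 (hG.toLp G) with hW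
  have hWf : f =ᵐ[volume] W := by
    refine ae_eq_of_forall_integral_schwartz_eq hf
      ((Lp.memLp W).locallyIntegrable (by norm_num)) fun φ => ?_
    have h1 := DFunLike.congr_fun (Lp.fourier_toTemperedDistribution_eq (hG.toLp G)) φ
    rw [TemperedDistribution.fourier_apply, Lp.toTemperedDistribution_apply,
      Lp.toTemperedDistribution_apply] at h1
    rw [h φ]
    simp only [smul_eq_mul] at h1
    rw [← hW] at h1
    rw [← h1]
    refine integral_congr_ae ?_
    filter_upwards [hG.coeFn_toLp] with x hx
    rw [hx]
  refine ⟨(memLp_congr_ae hWf).2 (Lp.memLp W), ?_⟩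
  rw [eLpNorm_congr_ae hWf, ← eLpNorm_congr_ae hG.coeFn_toLp, ← Lp.enorm_def, ← Lp.enorm_def]
  have : ‖W‖ = ‖hG.toLp G‖ := by
    rw [hW, Lp.norm_fourier_eq]
  rw [← ofReal_norm, ← ofReal_norm, this]

theorem IsGivenBy.integral_eq_fourierInv {U : 𝓢'(Space d, ℂ)} {u g : Space d → ℂ}
    (hu : IsGivenBy U u) (hg : IsGivenBy (𝓕 U) g) (φ : 𝓢(Space d, ℂ)) :
    ∫ x, φ x * u x = ∫ ξ, (𝓕⁻ φ) ξ * g ξ := by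
  rw [← hu.apply_eq, ← hg.apply_eq, TemperedDistribution.fourier_apply,
    FourierTransform.fourier_fourierInv_eq]

theorem IsGivenBy.integral_eq_fourier {U : 𝓢'(Space d, ℂ)} {u g : Space d → ℂ}
    (hu : IsGivenBy U u) (hg : IsGivenBy (𝓕 U) g) (φ : 𝓢(Space d, ℂ)) :
    ∫ x, φ x * g x = ∫ ξ, (𝓕 φ) ξ * u ξ := by
  rw [← hu.apply_eq, ← hg.apply_eq, TemperedDistribution.fourier_apply]

/-- Plancherel for tempered distributions given by functions. -/
theorem IsGivenBy.eLpNorm_fourier_eq {U : 𝓢'(Space d, ℂ)} {u g : Space d → ℂ}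
    (hu : IsGivenBy U u) (hg : IsGivenBy (𝓕 U) g) (h : MemLp u 2) :
    MemLp g 2 ∧ eLpNorm g 2 = eLpNorm u 2 :=
  memLp_two_of_integral_fourier_eq hg.locallyIntegrable h (hu.integral_eq_fourier hg)

/-- The smooth frequency cutoff: `1` on the unit ball, supported in the ball of radius `2`. -/
noncomputable def freqBump (d : ℕ) : ContDiffBump (0 : Space d) := ⟨1, 2, one_pos, one_lt_two⟩

theorem freqBump_eq_zero {ξ : Space d} (h : 2 ≤ ‖ξ‖) : freqBump d ξ = 0 :=
  (freqBump d).zero_of_le_dist (by simpa [freqBump] using h)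

theorem freqBump_eq_one {ξ : Space d} (h : ‖ξ‖ ≤ 1) : freqBump d ξ = 1 :=
  (freqBump d).one_of_mem_closedBall (by simpa [freqBump] using h)

theorem contDiff_freqBump : ContDiff ℝ (⊤ : ℕ∞) (freqBump d) := (freqBump d).contDiff

/-- The frequency cutoff as a Schwartz function. -/
noncomputable def freqBumpSchwartz (d : ℕ) : 𝓢(Space d, ℂ) :=
  HasCompactSupport.toSchwartzMap (f := fun ξ => (freqBump d ξ : ℂ))
    ((freqBump d).hasCompactSupport.comp_left (g := fun r : ℝ => (r : ℂ)) rfl)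
    (Complex.ofRealCLM.contDiff.comp contDiff_freqBump)

theorem exists_decay_fourierInv_freqBump (d N : ℕ) :
    ∃ K : ℝ, 0 < K ∧ ∀ z : Space d, ‖𝓕⁻ (fun ξ : Space d => (freqBump d ξ : ℂ)) z‖ ≤
      K * (1 + ‖z‖) ^ (-(N : ℝ)) := by
  set ψ : 𝓢(Space d, ℂ) := 𝓕⁻ (freqBumpSchwartz d)
  have hψ : ∀ z, ψ z = 𝓕⁻ (fun ξ : Space d => (freqBump d ξ : ℂ)) z := fun z => by
    simp only [ψ, SchwartzMap.fourierInv_coe]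
    rfl
  refine ⟨2 ^ N * (Finset.Iic (N, 0)).sup (fun m => SchwartzMap.seminorm ℂ m.1 m.2) ψ + 1,
    by positivity, fun z => ?_⟩
  have := SchwartzMap.one_add_le_sup_seminorm_apply (𝕜 := ℂ) (m := (N, 0)) (k := N) (n := 0)
    le_rfl le_rfl ψ z
  rw [← hψ, Real.rpow_neg (by positivity), Real.rpow_natCast, ← div_eq_mul_inv,
    le_div_iff₀ (by positivity), mul_comm]
  simp only [norm_iteratedFDeriv_zero] at this
  linarith

/-- The low-frequency part of a function with Fourier transform `g`. -/
noncomputable def lowFreq (g : Space d → ℂ) (M : ℝ) : Space d → ℂ :=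
  𝓕⁻ (fun ξ => (freqBump d (M⁻¹ • ξ) : ℂ) * g ξ)

/-- The cutoff at scale `M`, modulated by the character of `x`. -/
theorem exists_modulated_bump {M : ℝ} (hM : 0 < M) (x : Space d) :
    ∃ η : 𝓢(Space d, ℂ), ∀ ξ,
      η ξ = (Real.fourierChar (inner ℝ ξ x) : ℂ) * (freqBump d (M⁻¹ • ξ) : ℂ) := by
  have h1 : HasCompactSupport fun ξ : Space d =>
      (Real.fourierChar (inner ℝ ξ x) : ℂ) * (freqBump d (M⁻¹ • ξ) : ℂ) := by
    refine HasCompactSupport.intro (isCompact_closedBall (0 : Space d) (2 * M)) fun ξ hξ => ?_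
    rw [freqBump_eq_zero, Complex.ofReal_zero, mul_zero]
    simp only [Metric.mem_closedBall, dist_zero_right, not_le] at hξ
    rw [norm_smul, norm_inv, Real.norm_of_nonneg hM.le, ← div_eq_inv_mul, le_div_iff₀ hM]
    exact hξ.le
  have h2 : ContDiff ℝ (⊤ : ℕ∞) fun ξ : Space d =>
      (Real.fourierChar (inner ℝ ξ x) : ℂ) * (freqBump d (M⁻¹ • ξ) : ℂ) := by
    simp only [Real.fourierChar_apply]
    have := (contDiff_freqBump (d := d)).comp (contDiff_const_smul (𝕜 := ℝ) M⁻¹)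
    refine ContDiff.mul ?_ (Complex.ofRealCLM.contDiff.comp this)
    refine ContDiff.cexp (ContDiff.mul (Complex.ofRealCLM.contDiff.comp ?_) contDiff_const)
    exact contDiff_const.mul (contDiff_id.inner ℝ contDiff_const)
  exact ⟨h1.toSchwartzMap h2, fun ξ => rfl⟩

theorem fourier_modulated_bump {M : ℝ} (hM : 0 < M) (x y : Space d) {η : 𝓢(Space d, ℂ)}
    (hη : ∀ ξ, η ξ = (Real.fourierChar (inner ℝ ξ x) : ℂ) * (freqBump d (M⁻¹ • ξ) : ℂ)) :
    (𝓕 η) y = (M ^ d : ℝ) • 𝓕⁻ (fun ξ : Space d => (freqBump d ξ : ℂ)) (M • (x - y)) := by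
  rw [SchwartzMap.fourier_coe, Real.fourier_eq, Real.fourierInv_eq]
  have := Measure.integral_comp_inv_smul (volume : Measure (Space d))
    (fun v => Real.fourierChar (inner ℝ v (M • (x - y))) • (freqBump d v : ℂ)) M
  rw [abs_of_nonneg (by positivity), finrank_euclideanSpace_fin] at this
  rw [← this]
  congr 1
  ext v
  rw [hη, Circle.smul_def, Circle.smul_def, smul_eq_mul, smul_eq_mul, ← mul_assoc,
    ← Circle.coe_mul, ← AddChar.map_add_eq_mul]
  congr 4
  rw [inner_smul_left, inner_smul_right, inner_sub_right]
  simp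
  field_simp
  ring

/-- The value at `x` of the truncated inverse transform is the pairing of `g` with the modulated
bump; moving the Fourier transform onto the bump produces the rescaled kernel centred at `x`. -/
theorem IsGivenBy.lowFreq_eq {U : 𝓢'(Space d, ℂ)} {u g : Space d → ℂ}
    (hu : IsGivenBy U u) (hg : IsGivenBy (𝓕 U) g) {M : ℝ} (hM : 0 < M) (x : Space d) :
    lowFreq g M x = ∫ y, ((M ^ d : ℝ) •
      𝓕⁻ (fun ξ : Space d => (freqBump d ξ : ℂ)) (M • (x - y))) * u y := by
  obtain ⟨η, hη⟩ := exists_modulated_bump hM x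
  have h := hu.integral_eq_fourier hg η
  simp only [fourier_modulated_bump hM x _ hη] at h
  rw [← h, lowFreq, Real.fourierInv_eq]
  simp only [hη, Circle.smul_def, smul_eq_mul, mul_assoc]

theorem enorm_lowFreq_le_setLIntegral (g : Space d → ℂ) {M : ℝ} (hM : 0 < M) (x : Space d) :
    ‖lowFreq g M x‖ₑ ≤ ∫⁻ ξ in Metric.ball 0 (2 * M), ‖g ξ‖ₑ := by
  rw [lowFreq, Real.fourierInv_eq, ← lintegral_indicator Metric.isOpen_ball.measurableSet]
  refine (enorm_integral_le_lintegral_enorm _).trans (lintegral_mono fun ξ => ?_)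
  rw [Circle.smul_def, smul_eq_mul, enorm_mul, enorm_mul]
  have h1 : ‖(Real.fourierChar (inner ℝ ξ x) : ℂ)‖ₑ = 1 := by
    rw [← ofReal_norm, Circle.norm_coe, ENNReal.ofReal_one]
  rw [h1, one_mul]
  by_cases hξ : ξ ∈ Metric.ball (0 : Space d) (2 * M)
  · rw [Set.indicator_of_mem hξ]
    have : ‖((freqBump d (M⁻¹ • ξ) : ℝ) : ℂ)‖ₑ ≤ 1 := by
      rw [← ofReal_norm, Complex.norm_real, Real.norm_of_nonneg (freqBump d).nonneg]
      exact ENNReal.ofReal_le_one.2 (freqBump d).le_one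
    calc _ ≤ 1 * ‖g ξ‖ₑ := by gcongr
      _ = _ := one_mul _
  · rw [freqBump_eq_zero]
    · simp
    rw [norm_smul, norm_inv, Real.norm_of_nonneg hM.le, ← div_eq_inv_mul, le_div_iff₀ hM]
    simpa using hξ

theorem integrable_bump_mul {g : Space d → ℂ} (hg : LocallyIntegrable g) {M : ℝ} (hM : 0 < M) :
    Integrable fun ξ => (freqBump d (M⁻¹ • ξ) : ℂ) * g ξ := by
  have := hg.integrable_smul_left_of_hasCompactSupport
    (g := fun ξ : Space d => freqBump d (M⁻¹ • ξ))
    (contDiff_freqBump.continuous.comp (continuous_const_smul _))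
    (HasCompactSupport.intro (isCompact_closedBall (0 : Space d) (2 * M)) fun ξ hξ => by
      rw [freqBump_eq_zero]
      simp only [Metric.mem_closedBall, dist_zero_right, not_le] at hξ
      rw [norm_smul, norm_inv, Real.norm_of_nonneg hM.le, ← div_eq_inv_mul, le_div_iff₀ hM]
      exact hξ.le)
  simpa using! this

theorem continuous_lowFreq {g : Space d → ℂ} (hg : LocallyIntegrable g) {M : ℝ} (hM : 0 < M) :
    Continuous (lowFreq g M) :=
  VectorFourier.fourierIntegral_continuous (L := -innerₗ (Space d)) Real.continuous_fourierChar
    (by simpa using! continuous_inner.neg) (integrable_bump_mul hg hM)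

theorem integral_mul_lowFreq {g : Space d → ℂ} (hg : LocallyIntegrable g) {M : ℝ} (hM : 0 < M)
    (φ : 𝓢(Space d, ℂ)) :
    ∫ x, φ x * lowFreq g M x = ∫ ξ, (𝓕⁻ φ) ξ * ((freqBump d (M⁻¹ • ξ) : ℂ) * g ξ) := by
  have h := VectorFourier.integral_fourierIntegral_smul_eq_flip (L := -innerₗ (Space d))
    (μ := volume) (ν := volume) Real.continuous_fourierChar (by simpa using! continuous_inner.neg)
    (φ.integrable (μ := volume)) (integrable_bump_mul hg hM)
  have hflip : (-innerₗ (Space d)).flip = -innerₗ (Space d) := by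
    ext; simp [real_inner_comm]
  rw [hflip] at h
  refine Eq.trans h.symm (integral_congr_ae (Filter.Eventually.of_forall fun ξ => ?_))
  simp only [SchwartzMap.fourierInv_coe]
  rfl

/-- The difference has Fourier transform `(1 - χ(ξ/M)) g`, which vanishes for `‖ξ‖ ≤ M` and is
dominated by `g` elsewhere. Keeping the tail of `g` on the right, rather than a power of `M`, is
what the endpoint layer cake argument needs. -/
theorem IsGivenBy.lintegral_sub_lowFreq_le {U : 𝓢'(Space d, ℂ)} {u g : Space d → ℂ}
    (hu : IsGivenBy U u) (hg : IsGivenBy (𝓕 U) g) {M : ℝ} (hM : 0 < M) :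
    ∫⁻ x, ‖u x - lowFreq g M x‖ₑ ^ 2 ≤ ∫⁻ ξ in {ξ | M < ‖ξ‖}, ‖g ξ‖ₑ ^ 2 := by
  set G : Space d → ℂ := fun ξ => (1 - (freqBump d (M⁻¹ • ξ) : ℂ)) * g ξ with hGdef
  have hms : MeasurableSet {ξ : Space d | M < ‖ξ‖} :=
    measurableSet_lt measurable_const measurable_norm
  have hGle : ∫⁻ ξ, ‖G ξ‖ₑ ^ 2 ≤ ∫⁻ ξ in {ξ | M < ‖ξ‖}, ‖g ξ‖ₑ ^ 2 := by
    rw [← lintegral_indicator hms]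
    refine lintegral_mono fun ξ => ?_
    by_cases hξ : M < ‖ξ‖
    · rw [Set.indicator_of_mem (by exact hξ)]
      gcongr
      rw [hGdef, enorm_mul]
      have : ‖(1 - ((freqBump d (M⁻¹ • ξ) : ℝ) : ℂ))‖ₑ ≤ 1 := by
        rw [← ofReal_norm, ← Complex.ofReal_one, ← Complex.ofReal_sub, Complex.norm_real,
          Real.norm_of_nonneg (sub_nonneg.2 (freqBump d).le_one)]
        exact ENNReal.ofReal_le_one.2 (by linarith [(freqBump d).nonneg (x := M⁻¹ • ξ)])
      calc _ ≤ 1 * ‖g ξ‖ₑ := by gcongr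
        _ = _ := one_mul _
    · have : G ξ = 0 := by
        rw [hGdef]
        simp only
        rw [freqBump_eq_one]
        · simp
        rw [norm_smul, norm_inv, Real.norm_of_nonneg hM.le, ← div_eq_inv_mul, div_le_one hM]
        exact not_lt.1 hξ
      rw [this]; simp
  by_cases hfin : ∫⁻ ξ in {ξ | M < ‖ξ‖}, ‖g ξ‖ₑ ^ 2 = ∞
  · rw [hfin]; exact le_top
  have hsq : ∀ f : Space d → ℂ, eLpNorm f 2 volume ^ 2 = ∫⁻ x, ‖f x‖ₑ ^ 2 := fun f => by
    simpa using! eLpNorm_nnreal_pow_eq_lintegral (f := f) (μ := volume) (p := 2) two_ne_zero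
  have hGm : AEStronglyMeasurable G volume := by
    refine AEStronglyMeasurable.mul ?_ hg.locallyIntegrable.aestronglyMeasurable
    refine Continuous.aestronglyMeasurable ?_
    have := (contDiff_freqBump (d := d)).continuous.comp (continuous_const_smul M⁻¹)
    exact continuous_const.sub (Complex.continuous_ofReal.comp this)
  have hGL : MemLp G 2 := by
    refine ⟨hGm, ?_⟩
    have : eLpNorm G 2 volume ^ 2 < ∞ := by
      rw [hsq]; exact hGle.trans_lt (lt_top_iff_ne_top.2 hfin)
    simpa using this
  have hlow := continuous_lowFreq hg.locallyIntegrable hM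
  have hbd : ∃ C : ℝ, ∀ x, ‖lowFreq g M x‖ ≤ C := by
    refine ⟨∫ ξ, ‖(freqBump d (M⁻¹ • ξ) : ℂ) * g ξ‖, fun x => ?_⟩
    exact VectorFourier.norm_fourierIntegral_le_integral_norm _ _ _ _ _
  obtain ⟨C, hC⟩ := hbd
  have := memLp_two_of_integral_fourierInv_eq (f := fun x => u x - lowFreq g M x)
    (hu.locallyIntegrable.sub hlow.locallyIntegrable) hGL fun φ => by
      simp only [mul_sub, hGdef, sub_mul, one_mul]
      rw [integral_sub (hu.integrable φ), integral_sub (hg.integrable _),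
        hu.integral_eq_fourierInv hg, integral_mul_lowFreq hg.locallyIntegrable hM]
      · have := (integrable_bump_mul hg.locallyIntegrable hM).bdd_mul (c := ∫ x, ‖φ x‖)
          (f := (𝓕⁻ φ : 𝓢(Space d, ℂ))) (𝓕⁻ φ : 𝓢(Space d, ℂ)).continuous.aestronglyMeasurable
          (Filter.Eventually.of_forall fun x =>
            VectorFourier.norm_fourierIntegral_le_integral_norm _ _ _ _ _)
        exact this
      · exact (φ.integrable (μ := volume)).mul_bdd (c := C) hlow.aestronglyMeasurable
          (Filter.Eventually.of_forall hC)
  rw [← hsq (fun x => u x - lowFreq g M x), this.2, hsq]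
  exact hGle

end FourierSplitting

/-! ### Averages of `u` at a given scale, controlled by the Riesz norm -/

section KernelBounds

variable {d : ℕ}

/-- The volume of the unit ball of `ℝ^d`. -/
noncomputable def unitBallVol (d : ℕ) : ℝ := (volume (Metric.ball (0 : Space d) 1)).toReal

theorem unitBallVol_pos (d : ℕ) : 0 < unitBallVol d :=
  ENNReal.toReal_pos (Metric.measure_ball_pos _ _ one_pos).ne' measure_ball_lt_top.ne

theorem volume_ball_eq (x : Space d) {r : ℝ} (hr : 0 < r) :
    volume (Metric.ball x r) = ENNReal.ofReal (r ^ d * unitBallVol d) := by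
  rw [Measure.addHaar_ball_of_pos _ _ hr, finrank_euclideanSpace_fin,
    ENNReal.ofReal_mul (by positivity), unitBallVol, ENNReal.ofReal_toReal measure_ball_lt_top.ne]

theorem le_volume_shell (hd : d ≠ 0) {R δ : ℝ} (hR : 0 < R) (hδ : 0 < δ) :
    ENNReal.ofReal (unitBallVol d * R ^ (d - 1) * δ) ≤
      volume (Metric.ball (0 : Space d) (R + δ) \ Metric.ball 0 R) := by
  obtain ⟨n, rfl⟩ := Nat.exists_eq_succ_of_ne_zero hd
  have h1 : volume (Metric.ball (0 : Space (n + 1)) (R + δ)) ≤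
      volume (Metric.ball (0 : Space (n + 1)) (R + δ) \ Metric.ball 0 R) +
        volume (Metric.ball (0 : Space (n + 1)) R) := by
    refine (measure_mono ?_).trans (measure_union_le _ _)
    intro x hx
    by_cases h : x ∈ Metric.ball (0 : Space (n + 1)) R
    · exact Or.inr h
    · exact Or.inl ⟨hx, h⟩
  rw [volume_ball_eq _ (by positivity), volume_ball_eq _ hR] at h1
  have h2 := tsub_le_iff_right.2 h1
  refine le_trans ?_ h2
  rw [← ENNReal.ofReal_sub _ (mul_nonneg (by positivity) (unitBallVol_pos _).le)]
  refine ENNReal.ofReal_le_ofReal ?_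
  have h3 : R ^ n ≤ (R + δ) ^ n := by gcongr; linarith
  have hv := unitBallVol_pos (n + 1)
  simp only [Nat.succ_eq_add_one, Nat.add_sub_cancel]
  have h4 : R ^ n * δ ≤ (R + δ) ^ (n + 1) - R ^ (n + 1) := by
    rw [pow_succ, pow_succ]
    nlinarith
  nlinarith

/-- The polynomially decaying kernel of mass comparable to `1` at scale `1 / M`. -/
noncomputable def decayKer (d : ℕ) (N M : ℝ) (z : Space d) : ℝ≥0∞ :=
  ENNReal.ofReal (M ^ d * (1 + M * ‖z‖) ^ (-N))

theorem measurable_decayKer (N M : ℝ) : Measurable (decayKer d N M) := by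
  unfold decayKer
  fun_prop

theorem decayKer_le_scale {N M : ℝ} (hM : 0 < M) (hN : 0 ≤ N) (z : Space d) :
    decayKer d N M z ≤ ENNReal.ofReal (M ^ d) := by
  refine ENNReal.ofReal_le_ofReal (mul_le_of_le_one_right (by positivity) ?_)
  refine Real.rpow_le_one_of_one_le_of_nonpos ?_ (by linarith)
  have : 0 ≤ M * ‖z‖ := by positivity
  linarith

/-- The mass of `decayKer`. -/
noncomputable def decayMass (d : ℕ) (N : ℝ) : ℝ :=
  (∫⁻ z : Space d, ENNReal.ofReal ((1 + ‖z‖) ^ (-N))).toReal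

theorem lintegral_decayKer {N M : ℝ} (hM : 0 < M) (hN : d < N) (x : Space d) :
    ∫⁻ y, decayKer d N M (x - y) = ENNReal.ofReal (decayMass d N) := by
  rw [lintegral_sub_left_eq_self (fun z => decayKer d N M z) x, decayMass,
    ENNReal.ofReal_toReal (finite_integral_one_add_norm (by simpa using hN)).ne]
  have hm : Measurable fun z : Space d => ENNReal.ofReal ((1 + ‖z‖) ^ (-N)) := by fun_prop
  have h := lintegral_map (μ := (volume : Measure (Space d))) hm (measurable_const_smul M)
  have h2 := Measure.map_addHaar_smul (volume : Measure (Space d)) hM.ne'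
  rw [h2, lintegral_smul_measure, finrank_euclideanSpace_fin] at h
  have h3 : ∀ z : Space d, decayKer d N M z =
      ENNReal.ofReal (M ^ d) * ENNReal.ofReal ((1 + ‖M • z‖) ^ (-N)) := fun z => by
    rw [decayKer, ENNReal.ofReal_mul (by positivity), norm_smul, Real.norm_of_nonneg hM.le]
  simp only [h3]
  rw [lintegral_const_mul' _ _ ENNReal.ofReal_ne_top, ← h, smul_eq_mul, ← mul_assoc,
    ← ENNReal.ofReal_mul (by positivity), abs_of_pos (by positivity),
    mul_inv_cancel₀ (by positivity), ENNReal.ofReal_one, one_mul]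

theorem decayMass_nonneg (d : ℕ) (N : ℝ) : 0 ≤ decayMass d N := ENNReal.toReal_nonneg

/-- `u` is tested against the Riesz kernel smoothed at scale `ρ`. -/
theorem lintegral_mul_decay_le_riesz {α : ℝ} (hα : 0 < α) {u : Space d → ℂ} {a ρ : ℝ}
    (ha : 0 ≤ a) (hua : eLpNorm (rieszConv α u) 2 volume ≤ ENNReal.ofReal a) (hρ : 0 < ρ)
    (x : Space d) :
    ∫⁻ y, ‖u y‖ₑ * ENNReal.ofReal ((1 + ‖x - y‖ / ρ) ^ (-α)) ≤
      ENNReal.ofReal ((√(unitBallVol d))⁻¹ * ρ ^ (α - d / 2) * a) := by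
  set T := ∫⁻ y, ‖u y‖ₑ * ENNReal.ofReal ((1 + ‖x - y‖ / ρ) ^ (-α))
  -- Since `‖z - y‖ ≤ ρ + ‖x - y‖`, the smoothed kernel at `x` lies below `ρ ^ α` times the Riesz
  -- kernel at every `z` of the ball. As `T` does not depend on `z`, the square can then be averaged
  -- over the ball.
  have hpt : ∀ z ∈ Metric.ball x ρ, T ≤ ENNReal.ofReal (ρ ^ α) * rieszConv α u z := by
    intro z hz
    rw [rieszConv, ← lintegral_const_mul' _ _ ENNReal.ofReal_ne_top]
    refine lintegral_mono fun y => ?_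
    rw [mul_left_comm]
    gcongr
    rcases eq_or_ne z y with rfl | hzy
    · rw [sub_self, enorm_zero, ENNReal.zero_rpow_of_neg (by linarith), ENNReal.mul_top]
      · exact le_top
      · simpa using Real.rpow_pos_of_pos hρ α
    · have hpos : 0 < ‖z - y‖ := norm_pos_iff.2 (sub_ne_zero.2 hzy)
      rw [← ofReal_norm, ENNReal.ofReal_rpow_of_pos hpos, ← ENNReal.ofReal_mul (by positivity)]
      refine ENNReal.ofReal_le_ofReal ?_
      have h1 : ‖z - y‖ ≤ ρ + ‖x - y‖ := by
        have h2 : ‖z - x‖ < ρ := by simpa [dist_eq_norm] using hz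
        have : z - y = (z - x) + (x - y) := by abel
        rw [this]
        exact (norm_add_le _ _).trans (by linarith)
      have h3 : 1 + ‖x - y‖ / ρ = (ρ + ‖x - y‖) / ρ := by field_simp
      rw [h3, Real.div_rpow (by positivity) hρ.le, Real.rpow_neg hρ.le, div_inv_eq_mul, mul_comm]
      gcongr ?_ * ?_
      exact Real.rpow_le_rpow_of_nonpos hpos h1 (by linarith)
  have hsq : ∫⁻ z, rieszConv α u z ^ 2 ≤ ENNReal.ofReal (a ^ 2) := by
    have : eLpNorm (rieszConv α u) 2 volume ^ 2 = ∫⁻ x, rieszConv α u x ^ 2 := by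
      simpa using! eLpNorm_nnreal_pow_eq_lintegral (f := rieszConv α u) (μ := volume) (p := 2)
        two_ne_zero
    rw [← this, ENNReal.ofReal_pow ha]
    gcongr
  have hav : T ^ 2 * volume (Metric.ball x ρ) ≤ ENNReal.ofReal ((ρ ^ α) ^ 2 * a ^ 2) := by
    rw [← setLIntegral_const]
    calc ∫⁻ z in Metric.ball x ρ, T ^ 2
        ≤ ∫⁻ z in Metric.ball x ρ, ENNReal.ofReal ((ρ ^ α) ^ 2) * rieszConv α u z ^ 2 := by
          refine setLIntegral_mono' measurableSet_ball fun z hz => ?_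
          rw [ENNReal.ofReal_pow (by positivity), ← mul_pow]
          exact pow_le_pow_left₀ zero_le (hpt z hz) 2
      _ ≤ ∫⁻ z, ENNReal.ofReal ((ρ ^ α) ^ 2) * rieszConv α u z ^ 2 := setLIntegral_le_lintegral _ _
      _ ≤ _ := by
          rw [lintegral_const_mul' _ _ ENNReal.ofReal_ne_top, ENNReal.ofReal_mul (by positivity)]
          gcongr
  have hv := unitBallVol_pos d
  rw [volume_ball_eq _ hρ, ← ENNReal.le_div_iff_mul_le
    (Or.inl (by simp; positivity)) (Or.inl ENNReal.ofReal_ne_top),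
    ← ENNReal.ofReal_div_of_pos (by positivity)] at hav
  refine (ENNReal.pow_le_pow_left_iff two_ne_zero).1 (hav.trans ?_)
  rw [← ENNReal.ofReal_pow (by positivity)]
  refine ENNReal.ofReal_le_ofReal (le_of_eq ?_)
  have h5 : ρ ^ (α - d / 2) * ρ ^ (α - d / 2) = (ρ ^ α) ^ 2 / ρ ^ d := by
    rw [← Real.rpow_add hρ, ← Real.rpow_natCast ρ d, ← Real.rpow_natCast (ρ ^ α) 2,
      ← Real.rpow_mul hρ.le, ← Real.rpow_sub hρ]
    congr 1; push_cast; ring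
  have h6 : √(unitBallVol d) ^ 2 = unitBallVol d := Real.sq_sqrt hv.le
  calc (ρ ^ α) ^ 2 * a ^ 2 / (ρ ^ d * unitBallVol d)
      = (ρ ^ α) ^ 2 / ρ ^ d * (a ^ 2 / unitBallVol d) := by field_simp
    _ = _ := by
      rw [← h5, mul_pow, mul_pow, inv_pow, h6]; ring

/-- The kernel smoothed at scale `R` and centred at the origin is at least `2 ^ (-α)` on the ball.
The case `a = 0` is allowed and is used for the degenerate case of the theorem. -/
theorem setLIntegral_ball_le_riesz {α : ℝ} (hα : 0 < α) {u : Space d → ℂ} {a R : ℝ}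
    (ha : 0 ≤ a) (hua : eLpNorm (rieszConv α u) 2 volume ≤ ENNReal.ofReal a) (hR : 0 < R) :
    ∫⁻ y in Metric.ball 0 R, ‖u y‖ₑ ≤
      ENNReal.ofReal (2 ^ α * (√(unitBallVol d))⁻¹ * R ^ (α - d / 2) * a) := by
  have h := lintegral_mul_decay_le_riesz hα ha hua hR 0
  have h2 : ∫⁻ y in Metric.ball 0 R, ‖u y‖ₑ ≤
      ENNReal.ofReal (2 ^ α) * ∫⁻ y, ‖u y‖ₑ * ENNReal.ofReal ((1 + ‖0 - y‖ / R) ^ (-α)) := by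
    rw [← lintegral_const_mul' _ _ ENNReal.ofReal_ne_top]
    refine le_trans (setLIntegral_mono' measurableSet_ball fun y hy => ?_)
      (setLIntegral_le_lintegral _ _)
    rw [mul_left_comm, ← ENNReal.ofReal_mul (by positivity)]
    refine le_mul_of_one_le_right zero_le ?_
    rw [ENNReal.one_le_ofReal]
    have hy' : ‖y‖ < R := by simpa using hy
    have h3 : (1 + ‖0 - y‖ / R) ≤ 2 := by
      rw [zero_sub, norm_neg]
      have := (div_le_one hR).2 hy'.le
      linarith
    calc (1 : ℝ) = 2 ^ α * 2 ^ (-α) := by rw [← Real.rpow_add two_pos]; simp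
      _ ≤ _ := by
        gcongr ?_ * ?_
        exact Real.rpow_le_rpow_of_nonpos (by positivity) h3 (by linarith)
  refine h2.trans ?_
  refine (mul_le_mul_right h _).trans ?_
  rw [← ENNReal.ofReal_mul (by positivity)]
  refine ENNReal.ofReal_le_ofReal (le_of_eq ?_)
  ring

theorem lintegral_mul_decayKer_le_riesz {α : ℝ} (hα : 0 < α) {u : Space d → ℂ} {a N M : ℝ}
    (ha : 0 ≤ a) (hua : eLpNorm (rieszConv α u) 2 volume ≤ ENNReal.ofReal a) (hM : 0 < M)
    (hN : α ≤ N) (x : Space d) :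
    ∫⁻ y, ‖u y‖ₑ * decayKer d N M (x - y) ≤
      ENNReal.ofReal ((√(unitBallVol d))⁻¹ * M ^ (3 * d / 2 - α) * a) := by
  have h := lintegral_mul_decay_le_riesz hα ha hua (inv_pos.2 hM) x
  have h2 : ∫⁻ y, ‖u y‖ₑ * decayKer d N M (x - y) ≤ ENNReal.ofReal (M ^ d) *
      ∫⁻ y, ‖u y‖ₑ * ENNReal.ofReal ((1 + ‖x - y‖ / M⁻¹) ^ (-α)) := by
    rw [← lintegral_const_mul' _ _ ENNReal.ofReal_ne_top]
    refine lintegral_mono fun y => ?_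
    rw [mul_left_comm, decayKer, ENNReal.ofReal_mul (by positivity)]
    gcongr
    rw [div_inv_eq_mul, mul_comm M]
    have : 0 ≤ ‖x - y‖ * M := by positivity
    exact Real.rpow_le_rpow_of_exponent_le (by linarith) (by linarith)
  refine h2.trans ((mul_le_mul_right h _).trans ?_)
  rw [← ENNReal.ofReal_mul (by positivity)]
  refine ENNReal.ofReal_le_ofReal (le_of_eq ?_)
  have : M ^ (3 * d / 2 - α) = M ^ d * M⁻¹ ^ (α - d / 2) := by
    rw [Real.inv_rpow hM.le, ← Real.rpow_neg hM.le, ← Real.rpow_natCast, ← Real.rpow_add hM]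
    congr 1; ring
  rw [this]; ring

/-- Reflections act transitively on spheres. -/
theorem exists_linearIsometryEquiv_map_eq {x x' : Space d} (h : ‖x‖ = ‖x'‖) :
    ∃ A : Space d ≃ₗᵢ[ℝ] Space d, A x = x' :=
  ⟨(ℝ ∙ (x - x'))ᗮ.reflection, Submodule.reflection_sub h⟩

/-- A reflection carrying `x` to `x'` preserves the measure, the kernel and `‖u‖ₑ` almost
everywhere. -/
theorem lintegral_radial_conv_congr {u : Space d → ℂ} (hu : IsRadial u) (k : ℝ → ℝ≥0∞)
    {x x' : Space d} (h : ‖x‖ = ‖x'‖) :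
    ∫⁻ y, ‖u y‖ₑ * k ‖x - y‖ = ∫⁻ y, ‖u y‖ₑ * k ‖x' - y‖ := by
  obtain ⟨f, hf⟩ := hu
  obtain ⟨A, hA⟩ := exists_linearIsometryEquiv_map_eq h
  have h1 : ∀ w : Space d, ∫⁻ y, ‖u y‖ₑ * k ‖w - y‖ = ∫⁻ y : Space d, ‖f ‖y‖‖ₑ * k ‖w - y‖ :=
    fun w => lintegral_congr_ae (by filter_upwards [hf] with y hy; rw [hy])
  rw [h1, h1, ← A.measurePreserving.lintegral_comp_emb A.toHomeomorph.measurableEmbedding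
    (fun y => ‖f ‖y‖‖ₑ * k ‖x' - y‖)]
  refine lintegral_congr fun y => ?_
  rw [A.norm_map, ← hA, ← map_sub, A.norm_map]

/-- A shift by at most `1 / M` at most doubles `1 + M * ‖x - y‖`. -/
theorem lintegral_mul_decayKer_le_translate {u : Space d → ℂ} {N M : ℝ} (hM : 0 < M)
    (hN : 0 ≤ N) {x x' : Space d} (h : ‖x - x'‖ ≤ M⁻¹) :
    ∫⁻ y, ‖u y‖ₑ * decayKer d N M (x - y) ≤
      ENNReal.ofReal (2 ^ N) * ∫⁻ y, ‖u y‖ₑ * decayKer d N M (x' - y) := by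
  rw [← lintegral_const_mul' _ _ ENNReal.ofReal_ne_top]
  refine lintegral_mono fun y => ?_
  rw [mul_left_comm, decayKer, decayKer, ← ENNReal.ofReal_mul (by positivity)]
  refine mul_le_mul_right (ENNReal.ofReal_le_ofReal ?_) _
  rw [mul_left_comm]
  refine mul_le_mul_of_nonneg_left ?_ (by positivity)
  have h1 : ‖x' - y‖ ≤ M⁻¹ + ‖x - y‖ := by
    have : x' - y = -(x - x') + (x - y) := by abel
    rw [this]
    refine (norm_add_le _ _).trans ?_
    rw [norm_neg]; linarith
  have h2 : 1 + M * ‖x' - y‖ ≤ 2 * (1 + M * ‖x - y‖) := by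
    have : M * ‖x' - y‖ ≤ M * (M⁻¹ + ‖x - y‖) := by gcongr
    rw [mul_add, mul_inv_cancel₀ hM.ne'] at this
    nlinarith [mul_nonneg hM.le (norm_nonneg (x - y))]
  calc (1 + M * ‖x - y‖) ^ (-N)
      = 2 ^ N * (2 * (1 + M * ‖x - y‖)) ^ (-N) := by
        rw [Real.mul_rpow two_pos.le (by positivity), ← mul_assoc, ← Real.rpow_add two_pos]
        simp
    _ ≤ _ := by
      gcongr ?_ * ?_
      exact Real.rpow_le_rpow_of_nonpos (by positivity) h2 (by linarith)

/-- Convolutions of radial functions gain from averaging over a thin spherical shell. -/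
theorem lintegral_radial_mul_decayKer_le_riesz (hd : d ≠ 0) {α : ℝ} (hα : 0 < α)
    {u : Space d → ℂ} (hum : AEStronglyMeasurable u) (hu : IsRadial u) {a N M : ℝ}
    (ha : 0 ≤ a) (hua : eLpNorm (rieszConv α u) 2 volume ≤ ENNReal.ofReal a) (hM : 0 < M)
    (hN : α + d < N) {x : Space d} (hx : 1 ≤ M * ‖x‖) :
    ∫⁻ y, ‖u y‖ₑ * decayKer d N M (x - y) ≤
      ENNReal.ofReal (2 ^ N * 3 ^ α * decayMass d (N - α) * (√(unitBallVol d))⁻¹ *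
        (unitBallVol d)⁻¹ * ‖x‖ ^ (α - d / 2 - d + 1) * M * a) := by
  have hx0 : 0 < ‖x‖ := by
    rcases (norm_nonneg x).eq_or_lt with h | h
    · rw [← h] at hx; simp at hx; linarith
    · exact h
  set R := ‖x‖ with hR
  have hMR : M⁻¹ ≤ R := by rw [inv_le_iff_one_le_mul₀ hM]; linarith
  set S := Metric.ball (0 : Space d) (R + M⁻¹) \ Metric.ball 0 R with hS
  have hSm : MeasurableSet S := measurableSet_ball.diff measurableSet_ball
  set W : Space d → ℝ≥0∞ := fun x => ∫⁻ y, ‖u y‖ₑ * decayKer d N M (x - y) with hW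
  have hS1 : ∀ x' ∈ S, R ≤ ‖x'‖ ∧ ‖x'‖ < R + M⁻¹ := fun x' hx' => by
    simpa [hS, and_comm] using hx'
  -- Push `x` radially to the sphere through `x'`: the displacement is at most `1 / M`, and `W` is
  -- constant on that sphere.
  have hcmp : ∀ x' ∈ S, W x ≤ ENNReal.ofReal (2 ^ N) * W x' := by
    intro x' hx'
    obtain ⟨h1, h2⟩ := hS1 x' hx'
    have h3 : ‖(‖x'‖ / R) • x‖ = ‖x'‖ := by
      rw [norm_smul, Real.norm_of_nonneg (by positivity), ← hR]; field_simp
    have h4 : W ((‖x'‖ / R) • x) = W x' :=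
      lintegral_radial_conv_congr hu
        (fun r => ENNReal.ofReal (M ^ d * (1 + M * r) ^ (-N))) h3
    rw [← h4]
    refine lintegral_mul_decayKer_le_translate hM (by linarith [(Nat.cast_nonneg d : (0:ℝ) ≤ d)]) ?_
    have h5 : x - (‖x'‖ / R) • x = -((‖x'‖ / R - 1) • x) := by rw [sub_smul, one_smul]; abel
    have h6 : 0 ≤ ‖x'‖ / R - 1 := by rw [sub_nonneg, one_le_div hx0]; exact h1
    rw [h5, norm_neg, norm_smul, Real.norm_of_nonneg h6, ← hR, sub_mul, div_mul_cancel₀ _ hx0.ne']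
    linarith
  -- Of the decay `N`, a part `α` is spent on a Riesz weight of scale `R` centred at the origin; the
  -- remaining `N - α > d` keeps the kernel integrable in `x'`.
  have hint : ∫⁻ x' in S, W x' ≤ ENNReal.ofReal (3 ^ α * decayMass d (N - α) *
      ((√(unitBallVol d))⁻¹ * R ^ (α - d / 2) * a)) := by
    have hdm : 0 ≤ decayMass d (N - α) := ENNReal.toReal_nonneg
    have hswap : ∫⁻ x' in S, W x' = ∫⁻ y, ∫⁻ x' in S, ‖u y‖ₑ * decayKer d N M (x' - y) := by
      refine lintegral_lintegral_swap ?_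
      refine AEMeasurable.mul (f := fun z : Space d × Space d => ‖u z.2‖ₑ)
        (g := fun z : Space d × Space d => decayKer d N M (z.1 - z.2)) ?_ ?_
      · exact hum.enorm.comp_snd
      · exact ((measurable_decayKer N M).comp (measurable_fst.sub measurable_snd)).aemeasurable
    rw [hswap, ENNReal.ofReal_mul (by positivity)]
    refine le_trans ?_ (mul_le_mul_right (lintegral_mul_decay_le_riesz hα ha hua hx0 0) _)
    rw [← lintegral_const_mul' _ _ ENNReal.ofReal_ne_top]
    refine lintegral_mono fun y => ?_
    rw [lintegral_const_mul' _ _ enorm_ne_top, mul_left_comm]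
    gcongr
    rw [ENNReal.ofReal_mul (by positivity), mul_assoc, mul_comm (ENNReal.ofReal (decayMass _ _)),
      ← mul_assoc, ← ENNReal.ofReal_mul (by positivity),
      ← lintegral_decayKer hM (by linarith) y,
      ← lintegral_const_mul' _ _ ENNReal.ofReal_ne_top]
    refine le_trans (setLIntegral_mono' hSm fun x' hx' => ?_) (setLIntegral_le_lintegral _ _)
    obtain ⟨h1, h2⟩ := hS1 x' hx'
    rw [decayKer, decayKer, ← ENNReal.ofReal_mul (by positivity), norm_sub_rev y x']
    refine ENNReal.ofReal_le_ofReal ?_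
    rw [mul_left_comm]
    gcongr
    set t := ‖x' - y‖
    have ht : 0 ≤ t := norm_nonneg _
    -- On the shell `‖x'‖ ≤ R + 1/M ≤ 2R`, and `1/R ≤ M`; this is where the factor `3 ^ α` comes
    -- from.
    have h7 : 1 + ‖0 - y‖ / R ≤ 3 * (1 + M * t) := by
      have h8 : ‖0 - y‖ ≤ 2 * R + t := by
        have : (0 : Space d) - y = -x' + (x' - y) := by abel
        rw [this]
        refine (norm_add_le _ _).trans ?_
        rw [norm_neg]; linarith
      have h9 : ‖0 - y‖ / R ≤ 2 + t / R := by
        rw [div_le_iff₀ hx0, add_mul, div_mul_cancel₀ _ hx0.ne']; linarith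
      have h10 : t / R ≤ M * t := by
        rw [div_le_iff₀ hx0]; nlinarith
      nlinarith [mul_nonneg hM.le ht]
    have h11 : 0 < 1 + M * t := by positivity
    calc (1 + M * t) ^ (-N) = 3 ^ α * (3 * (1 + M * t)) ^ (-α) * (1 + M * t) ^ (-(N - α)) := by
          rw [Real.mul_rpow (by norm_num) h11.le, ← mul_assoc, ← Real.rpow_add (by norm_num),
            add_neg_cancel, Real.rpow_zero, one_mul, ← Real.rpow_add h11]
          congr 1; ring
      _ ≤ _ := by
          gcongr ?_ * ?_ * ?_
          exact Real.rpow_le_rpow_of_nonpos (by positivity) h7 (by linarith)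
  have hv := unitBallVol_pos d
  have hav : W x * volume S ≤ ENNReal.ofReal (2 ^ N) * ∫⁻ x' in S, W x' := by
    rw [← setLIntegral_const, ← lintegral_const_mul' _ _ ENNReal.ofReal_ne_top]
    exact setLIntegral_mono' hSm hcmp
  have hfin : W x * ENNReal.ofReal (unitBallVol d * R ^ (d - 1) * M⁻¹) ≤
      ENNReal.ofReal (2 ^ N * (3 ^ α * decayMass d (N - α) *
      ((√(unitBallVol d))⁻¹ * R ^ (α - d / 2) * a))) := by
    refine (mul_le_mul_right (le_volume_shell hd hx0 (inv_pos.2 hM)) _).trans (hav.trans ?_)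
    rw [ENNReal.ofReal_mul (by positivity)]
    exact mul_le_mul_right hint _
  rw [← ENNReal.le_div_iff_mul_le
    (Or.inl (by simp; positivity)) (Or.inl ENNReal.ofReal_ne_top),
    ← ENNReal.ofReal_div_of_pos (by positivity)] at hfin
  refine hfin.trans (ENNReal.ofReal_le_ofReal (le_of_eq ?_))
  have h12 : R ^ (α - d / 2 - d + 1) = R ^ (α - d / 2) / R ^ (d - 1) := by
    rw [← Real.rpow_natCast R (d - 1), ← Real.rpow_sub hx0, Nat.cast_pred (Nat.pos_of_ne_zero hd)]
    congr 1; ring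
  rw [h12]
  field_simp

/-- Hölder for `‖u‖ k = (‖u‖ ^ q k) ^ (1/q) * k ^ (1 - 1/q)`, with `k ≤ M ^ d` in the first factor
and the mass of `k` in the second. -/
theorem lintegral_mul_decayKer_le_lintegral_rpow {u : Space d → ℂ} (hum : AEStronglyMeasurable u)
    {q N M : ℝ} (hq : 1 ≤ q) (hM : 0 < M) (hN : d < N) (x : Space d) :
    ∫⁻ y, ‖u y‖ₑ * decayKer d N M (x - y) ≤
      ENNReal.ofReal (decayMass d N ^ (1 - 1 / q) * M ^ (d / q)) *
        (∫⁻ y, ‖u y‖ₑ ^ q) ^ (1 / q) := by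
  have hq0 : 0 < q := by linarith
  have hN0 : 0 ≤ N := le_trans (Nat.cast_nonneg d) hN.le
  have hq1 : 1 / q ≤ 1 := (div_le_one hq0).2 hq
  have hk : Measurable fun y => decayKer d N M (x - y) :=
    (measurable_decayKer N M).comp (measurable_const.sub measurable_id)
  have h := ENNReal.lintegral_mul_norm_pow_le (μ := (volume : Measure (Space d)))
    (f := fun y => ‖u y‖ₑ ^ q * decayKer d N M (x - y)) (g := fun y => decayKer d N M (x - y))
    (p := 1 / q) (q := 1 - 1 / q) ((hum.enorm.pow_const q).mul hk.aemeasurable) hk.aemeasurable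
    (by positivity) (by linarith) (by ring)
  have h1 : ∀ y, (‖u y‖ₑ ^ q * decayKer d N M (x - y)) ^ (1 / q) *
      decayKer d N M (x - y) ^ (1 - 1 / q) = ‖u y‖ₑ * decayKer d N M (x - y) := fun y => by
    have hk0 : 0 < M ^ d * (1 + M * ‖x - y‖) ^ (-N) := by positivity
    rw [ENNReal.mul_rpow_of_nonneg _ _ (by positivity), ← ENNReal.rpow_mul,
      mul_one_div_cancel hq0.ne', ENNReal.rpow_one, mul_assoc, ← ENNReal.rpow_add]
    · simp
    · simpa [decayKer] using hk0
    · exact ENNReal.ofReal_ne_top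
  simp only [h1] at h
  refine h.trans ?_
  rw [lintegral_decayKer hM hN, ENNReal.ofReal_rpow_of_nonneg (decayMass_nonneg d N) (by linarith)]
  have h2 : ∫⁻ y, ‖u y‖ₑ ^ q * decayKer d N M (x - y) ≤
      ENNReal.ofReal (M ^ d) * ∫⁻ y, ‖u y‖ₑ ^ q := by
    rw [← lintegral_const_mul' _ _ ENNReal.ofReal_ne_top]
    refine lintegral_mono fun y => ?_
    rw [mul_comm]
    gcongr
    exact decayKer_le_scale hM hN0 _
  have h3 : ENNReal.ofReal (M ^ d) ^ (1 / q) = ENNReal.ofReal (M ^ (d / q)) := by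
    rw [ENNReal.ofReal_rpow_of_pos (by positivity), ← Real.rpow_natCast, ← Real.rpow_mul hM.le,
      mul_one_div]
  calc _ ≤ (ENNReal.ofReal (M ^ d) * ∫⁻ y, ‖u y‖ₑ ^ q) ^ (1 / q) *
        ENNReal.ofReal (decayMass d N ^ (1 - 1 / q)) := by gcongr
    _ = _ := by
      rw [ENNReal.mul_rpow_of_nonneg _ _ (by positivity), h3,
        ENNReal.ofReal_mul (Real.rpow_nonneg (decayMass_nonneg d N) _)]
      ring

end KernelBounds

/-! ### Layer cake with a level-dependent frequency cutoff -/

section LevelSets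

variable {d : ℕ}

/-- A radial function `u` with Fourier transform `g`, with bound `a` for the `L²` norm of its Riesz
convolution and bound `b` for the homogeneous Sobolev norm. -/
structure RadialBounds (d : ℕ) (s α : ℝ) (u g : Space d → ℂ) (a b : ℝ) : Prop where
  exists_fourier : ∃ U : 𝓢'(Space d, ℂ), IsGivenBy U u ∧ IsGivenBy (𝓕 U) g
  radial : IsRadial u
  riesz_pos : 0 < a
  deriv_pos : 0 < b
  riesz_le : eLpNorm (rieszConv α u) 2 volume ≤ ENNReal.ofReal a
  deriv_le : ∫⁻ ξ, ‖ξ‖ₑ ^ (2 * s) * ‖g ξ‖ₑ ^ 2 ≤ ENNReal.ofReal (b ^ 2)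

namespace RadialBounds

variable {s α : ℝ} {u g : Space d → ℂ} {a b : ℝ}

theorem aestronglyMeasurable (h : RadialBounds d s α u g a b) : AEStronglyMeasurable u := by
  obtain ⟨U, hu, -⟩ := h.exists_fourier
  exact hu.locallyIntegrable.aestronglyMeasurable

theorem aestronglyMeasurable_fourier (h : RadialBounds d s α u g a b) :
    AEStronglyMeasurable g := by
  obtain ⟨U, -, hg⟩ := h.exists_fourier
  exact hg.locallyIntegrable.aestronglyMeasurable

theorem aestronglyMeasurable_sub_lowFreq (h : RadialBounds d s α u g a b) {M : ℝ} (hM : 0 < M) :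
    AEStronglyMeasurable fun x => u x - lowFreq g M x := by
  obtain ⟨U, -, hg⟩ := h.exists_fourier
  exact h.aestronglyMeasurable.sub
    (continuous_lowFreq hg.locallyIntegrable hM).aestronglyMeasurable

theorem lintegral_sub_lowFreq_le (h : RadialBounds d s α u g a b) {M : ℝ} (hM : 0 < M) :
    ∫⁻ x, ‖u x - lowFreq g M x‖ₑ ^ 2 ≤ ∫⁻ ξ in {ξ | M < ‖ξ‖}, ‖g ξ‖ₑ ^ 2 := by
  obtain ⟨U, hu, hg⟩ := h.exists_fourier
  exact hu.lintegral_sub_lowFreq_le hg hM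

theorem lintegral_sub_lowFreq_le_rpow (h : RadialBounds d s α u g a b) (hs : 0 ≤ s) {M : ℝ}
    (hM : 0 < M) :
    ∫⁻ x, ‖u x - lowFreq g M x‖ₑ ^ 2 ≤ ENNReal.ofReal (M ^ (-(2 * s)) * b ^ 2) := by
  refine (h.lintegral_sub_lowFreq_le hM).trans ?_
  have hms : MeasurableSet {ξ : Space d | M < ‖ξ‖} :=
    measurableSet_lt measurable_const measurable_norm
  rw [ENNReal.ofReal_mul (by positivity)]
  refine le_trans ?_ (mul_le_mul_right h.deriv_le _)
  rw [← lintegral_const_mul' _ _ ENNReal.ofReal_ne_top]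
  refine le_trans (setLIntegral_mono' hms fun ξ hξ => ?_) (setLIntegral_le_lintegral _ _)
  rw [← mul_assoc]
  refine le_mul_of_one_le_left zero_le ?_
  have hξ' : M < ‖ξ‖ := hξ
  rw [← ofReal_norm, ENNReal.ofReal_rpow_of_pos (hM.trans hξ'),
    ← ENNReal.ofReal_mul (by positivity), ENNReal.one_le_ofReal, Real.rpow_neg hM.le,
    ← div_eq_inv_mul, one_le_div (by positivity)]
  exact Real.rpow_le_rpow hM.le hξ'.le (by positivity)

end RadialBounds

/-- The kernel of the smooth cutoff is Schwartz. From here on only the modulus of `u` against a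
positive radial kernel matters, and `K` is independent of `u` and `M`. -/
theorem exists_enorm_lowFreq_le_decayKer (d N : ℕ) :
    ∃ K : ℝ, 0 < K ∧ ∀ {s α : ℝ} {u g : Space d → ℂ} {a b : ℝ}, RadialBounds d s α u g a b →
      ∀ M : ℝ, 0 < M → ∀ x, ‖lowFreq g M x‖ₑ ≤
        ENNReal.ofReal K * ∫⁻ y, ‖u y‖ₑ * decayKer d N M (x - y) := by
  obtain ⟨K, hK, hdec⟩ := exists_decay_fourierInv_freqBump d N
  refine ⟨K, hK, fun {s α u g a b} h M hM x => ?_⟩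
  obtain ⟨U, hu, hg⟩ := h.exists_fourier
  rw [hu.lowFreq_eq hg hM, ← lintegral_const_mul' _ _ ENNReal.ofReal_ne_top]
  refine (enorm_integral_le_lintegral_enorm _).trans (lintegral_mono fun y => ?_)
  rw [enorm_mul, mul_comm, mul_left_comm]
  gcongr
  rw [decayKer, ← ENNReal.ofReal_mul hK.le, ← ofReal_norm, norm_smul,
    Real.norm_of_nonneg (by positivity)]
  refine ENNReal.ofReal_le_ofReal ?_
  have := hdec (M • (x - y))
  rw [norm_smul, Real.norm_of_nonneg hM.le] at this
  calc M ^ d * ‖𝓕⁻ (fun ξ : Space d => (freqBump d ξ : ℂ)) (M • (x - y))‖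
      ≤ M ^ d * (K * (1 + M * ‖x - y‖) ^ (-(N : ℝ))) := by gcongr
    _ = _ := by ring

theorem setLIntegral_Ioo_rpow {r T : ℝ} (hr : -1 < r) (hT : 0 ≤ T) :
    ∫⁻ t in Set.Ioo 0 T, ENNReal.ofReal (t ^ r) = ENNReal.ofReal (T ^ (r + 1) / (r + 1)) := by
  have hi : IntegrableOn (fun t : ℝ => t ^ r) (Set.Ioo 0 T) := by
    have := (intervalIntegral.intervalIntegrable_rpow' (a := 0) (b := T) hr).1
    exact this.mono_set Set.Ioo_subset_Ioc_self
  rw [← ofReal_integral_eq_lintegral_ofReal hi]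
  · rw [← integral_Ioc_eq_integral_Ioo, ← intervalIntegral.integral_of_le hT,
      integral_rpow (Or.inl hr), Real.zero_rpow (by linarith), sub_zero]
  · filter_upwards [self_mem_ae_restrict measurableSet_Ioo] with t ht
    exact Real.rpow_nonneg ht.1.le _

/-- A growth bound for the low frequencies improves to an `Lᵖ` bound, by the layer cake formula
with a frequency cutoff depending on the level. -/
theorem RadialBounds.lintegral_rpow_le_of_lowFreq_le {s α : ℝ} {u g : Space d → ℂ} {a b : ℝ}
    (h : RadialBounds d s α u g a b) (hs : 0 < s) {Λ σ : ℝ} (hΛ : 0 < Λ) (hσ : 0 < σ)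
    (hlow : ∀ M : ℝ, 0 < M → ∀ x, ‖lowFreq g M x‖ₑ ≤ ENNReal.ofReal (Λ * M ^ σ)) :
    ∫⁻ x, ‖u x‖ₑ ^ (2 + 2 * s / σ) ≤ ENNReal.ofReal
      ((2 + 2 * s / σ) * (4 * ((2 * Λ) ^ (2 * s / σ) / (2 * s / σ)) * b ^ 2)) := by
  set r := 2 * s / σ with hr
  have hr0 : 0 < r := by positivity
  have hcake := lintegral_rpow_eq_lintegral_meas_lt_mul (volume : Measure (Space d))
    (f := fun x => ‖u x‖) (Filter.Eventually.of_forall fun x => norm_nonneg _)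
    h.aestronglyMeasurable.norm.aemeasurable (p := 2 + r) (by positivity)
  have hconv : ∀ x, ENNReal.ofReal (‖u x‖ ^ (2 + r)) = ‖u x‖ₑ ^ (2 + r) := fun x => by
    rw [← ENNReal.ofReal_rpow_of_nonneg (norm_nonneg _) (by positivity), ofReal_norm]
  simp only [hconv] at hcake
  rw [hcake, ENNReal.ofReal_mul (by positivity)]
  refine mul_le_mul_right ?_ _
  -- `E` encodes `M(t) < ‖ξ‖`, where `Λ * M(t) ^ σ = t / 2`.
  set E : Set (ℝ × Space d) := {z | z.1 < 2 * Λ * ‖z.2‖ ^ σ} with hE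
  set F : ℝ → Space d → ℝ≥0∞ := fun t ξ =>
    E.indicator (fun z => ENNReal.ofReal (4 * z.1 ^ (r - 1)) * ‖g z.2‖ₑ ^ 2) (t, ξ) with hF
  have hEm : MeasurableSet E := by
    refine measurableSet_lt measurable_fst ?_
    fun_prop
  have hlevel : ∀ t ∈ Set.Ioi (0 : ℝ),
      volume {x | t < ‖u x‖} * ENNReal.ofReal (t ^ (2 + r - 1)) ≤ ∫⁻ ξ, F t ξ := by
    intro t ht
    have ht0 : 0 < t := ht
    set M := (t / (2 * Λ)) ^ σ⁻¹ with hM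
    have hM0 : 0 < M := by positivity
    have hMσ : Λ * M ^ σ = t / 2 := by
      rw [hM, ← Real.rpow_mul (by positivity), inv_mul_cancel₀ hσ.ne', Real.rpow_one]; field_simp
    have hsub : volume {x | t < ‖u x‖} ≤
        volume {x | ENNReal.ofReal ((t / 2) ^ 2) ≤ ‖u x - lowFreq g M x‖ₑ ^ 2} := by
      refine measure_mono fun x hx => ?_
      have hx' : t < ‖u x‖ := hx
      have h1 := hlow M hM0 x
      rw [hMσ, ← ofReal_norm, ENNReal.ofReal_le_ofReal_iff (by positivity)] at h1
      have h2 : t / 2 ≤ ‖u x - lowFreq g M x‖ := by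
        have := norm_sub_norm_le (u x) (lowFreq g M x)
        linarith
      change ENNReal.ofReal ((t / 2) ^ 2) ≤ ‖u x - lowFreq g M x‖ₑ ^ 2
      rw [ENNReal.ofReal_pow (by positivity), ← ofReal_norm]
      gcongr
    have hcheb := mul_meas_ge_le_lintegral₀ (μ := (volume : Measure (Space d)))
      ((h.aestronglyMeasurable_sub_lowFreq hM0).enorm.pow_const 2) (ENNReal.ofReal ((t / 2) ^ 2))
    have hms : MeasurableSet {ξ : Space d | M < ‖ξ‖} :=
      measurableSet_lt measurable_const measurable_norm
    calc volume {x | t < ‖u x‖} * ENNReal.ofReal (t ^ (2 + r - 1))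
        = ENNReal.ofReal (4 * t ^ (r - 1)) *
            (ENNReal.ofReal ((t / 2) ^ 2) * volume {x | t < ‖u x‖}) := by
          rw [← mul_assoc, ← ENNReal.ofReal_mul (by positivity), mul_comm]
          congr 2
          have : 2 + r - 1 = r - 1 + (2 : ℕ) := by push_cast; ring
          rw [this, Real.rpow_add ht0, Real.rpow_natCast]; ring
      _ ≤ ENNReal.ofReal (4 * t ^ (r - 1)) * ∫⁻ ξ in {ξ | M < ‖ξ‖}, ‖g ξ‖ₑ ^ 2 := by
          refine mul_le_mul_right ?_ _
          exact (mul_le_mul_right hsub _).trans (hcheb.trans (h.lintegral_sub_lowFreq_le hM0))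
      _ = ∫⁻ ξ in {ξ | M < ‖ξ‖}, ENNReal.ofReal (4 * t ^ (r - 1)) * ‖g ξ‖ₑ ^ 2 :=
          (lintegral_const_mul' _ _ ENNReal.ofReal_ne_top).symm
      _ ≤ ∫⁻ ξ in {ξ | M < ‖ξ‖}, F t ξ := by
          refine setLIntegral_mono' hms fun ξ hξ => ?_
          have hξ' : M < ‖ξ‖ := hξ
          have hmem : (t, ξ) ∈ E := by
            change t < 2 * Λ * ‖ξ‖ ^ σ
            have : M ^ σ < ‖ξ‖ ^ σ := Real.rpow_lt_rpow hM0.le hξ' hσ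
            nlinarith
          simp only [hF]
          rw [Set.indicator_of_mem hmem]
      _ ≤ ∫⁻ ξ, F t ξ := setLIntegral_le_lintegral _ _
  calc ∫⁻ t in Set.Ioi 0, volume {x | t < ‖u x‖} * ENNReal.ofReal (t ^ (2 + r - 1))
      ≤ ∫⁻ t in Set.Ioi 0, ∫⁻ ξ, F t ξ := setLIntegral_mono' measurableSet_Ioi hlevel
    _ = ∫⁻ ξ, ∫⁻ t in Set.Ioi 0, F t ξ := by
        refine lintegral_lintegral_swap ?_
        refine AEMeasurable.indicator (f := fun z : ℝ × Space d =>
          ENNReal.ofReal (4 * z.1 ^ (r - 1)) * ‖g z.2‖ₑ ^ 2) ?_ hEm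
        refine AEMeasurable.mul
          (f := fun z : ℝ × Space d => ENNReal.ofReal (4 * z.1 ^ (r - 1)))
          (g := fun z : ℝ × Space d => ‖g z.2‖ₑ ^ 2) (by fun_prop) ?_
        exact (h.aestronglyMeasurable_fourier.enorm.pow_const 2).comp_snd
    -- Integrating in `t` first gives `T ^ r / r` with `T ^ r` proportional to `‖ξ‖ ^ (2 * s)`, by
    -- the choice `r = 2 * s / σ`. Bounding the tail by `M ^ (-2s) * b ^ 2` before integrating would
    -- leave a divergent `∫ dt/t`.
    _ ≤ ∫⁻ ξ, ENNReal.ofReal (4 * ((2 * Λ) ^ r / r)) * (‖ξ‖ₑ ^ (2 * s) * ‖g ξ‖ₑ ^ 2) := by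
        refine lintegral_mono fun ξ => ?_
        set T := 2 * Λ * ‖ξ‖ ^ σ with hT
        have hT0 : 0 ≤ T := by positivity
        have h1 : ∫⁻ t in Set.Ioi 0, F t ξ =
            ∫⁻ t in Set.Ioo 0 T, ENNReal.ofReal 4 * ‖g ξ‖ₑ ^ 2 * ENNReal.ofReal (t ^ (r - 1)) := by
          rw [← lintegral_indicator measurableSet_Ioi, ← lintegral_indicator measurableSet_Ioo]
          refine lintegral_congr fun t => ?_
          by_cases ht : 0 < t
          · rw [Set.indicator_of_mem (by exact ht)]
            by_cases htT : t < T
            · rw [Set.indicator_of_mem (by exact ⟨ht, htT⟩)]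
              simp only [hF]
              rw [Set.indicator_of_mem (by exact htT), ENNReal.ofReal_mul (by norm_num)]
              ring
            · rw [Set.indicator_of_notMem (fun hh => htT hh.2)]
              simp only [hF]
              rw [Set.indicator_of_notMem (by exact htT)]
          · rw [Set.indicator_of_notMem (by exact ht), Set.indicator_of_notMem (fun hh => ht hh.1)]
        have h2 : T ^ r = (2 * Λ) ^ r * ‖ξ‖ ^ (2 * s) := by
          rw [hT, Real.mul_rpow (by positivity) (by positivity), ← Real.rpow_mul (norm_nonneg _)]
          congr 2
          rw [hr]; field_simp
        have h3 : ‖ξ‖ₑ ^ (2 * s) = ENNReal.ofReal (‖ξ‖ ^ (2 * s)) := by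
          rw [← ENNReal.ofReal_rpow_of_nonneg (norm_nonneg _) (by positivity), ofReal_norm]
        rw [h1, lintegral_const_mul'' _ (by fun_prop), setLIntegral_Ioo_rpow (by linarith) hT0,
          sub_add_cancel, h2, h3, ← mul_assoc, ← ENNReal.ofReal_mul (by positivity),
          mul_right_comm, ← ENNReal.ofReal_mul (by norm_num)]
        refine le_of_eq ?_
        congr 2
        ring
    _ = ENNReal.ofReal (4 * ((2 * Λ) ^ r / r)) * ∫⁻ ξ, ‖ξ‖ₑ ^ (2 * s) * ‖g ξ‖ₑ ^ 2 :=
        lintegral_const_mul' _ _ ENNReal.ofReal_ne_top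
    _ ≤ _ := by
        rw [ENNReal.ofReal_mul (q := b ^ 2) (by positivity)]
        exact mul_le_mul_right h.deriv_le _

end LevelSets

/-! ### Interpolation and the exponents above two -/

section Inequalities

variable {d : ℕ}

/-- The exponent of the Sobolev norm in the bound for `∫ |u|ᵖ` dictated by scaling. -/
noncomputable def scalingExp (d : ℕ) (s α p : ℝ) : ℝ :=
  ((3 * d / 2 - α) * p - d) / (d - α + s)

/-- The Gagliardo–Nirenberg type inequality with exponent `p`, in terms of `∫ |u|ᵖ`. -/
def RadialIneq (d : ℕ) (s α p : ℝ) : Prop :=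
  ∃ C : ℝ, 0 < C ∧ ∀ (u g : Space d → ℂ) (a b : ℝ), RadialBounds d s α u g a b →
    ∫⁻ x, ‖u x‖ₑ ^ p ≤
      ENNReal.ofReal (C * (a ^ (p - scalingExp d s α p) * b ^ scalingExp d s α p))

/-- Hölder between the two integrals; the powers of `a` and `b` match because `scalingExp` is affine
in `p`. -/
theorem RadialIneq.interpolate {s α p₁ p₂ p : ℝ} (h₁ : RadialIneq d s α p₁)
    (h₂ : RadialIneq d s α p₂) (hp₁ : 0 < p₁) (h1p : p₁ ≤ p) (hp2 : p ≤ p₂) :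
    RadialIneq d s α p := by
  rcases h1p.eq_or_lt with rfl | h1p
  · exact h₁
  obtain ⟨C₁, hC₁, H₁⟩ := h₁
  obtain ⟨C₂, hC₂, H₂⟩ := h₂
  have h12 : 0 < p₂ - p₁ := by linarith
  set t := (p₂ - p) / (p₂ - p₁) with ht
  have ht0 : 0 ≤ t := div_nonneg (by linarith) h12.le
  have ht1 : t ≤ 1 := (div_le_one h12).2 (by linarith)
  have hpt : t * p₁ + (1 - t) * p₂ = p := by rw [ht]; field_simp; ring
  have hτ : t * scalingExp d s α p₁ + (1 - t) * scalingExp d s α p₂ = scalingExp d s α p := by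
    simp only [scalingExp]
    rw [← hpt]; ring
  refine ⟨C₁ ^ t * C₂ ^ (1 - t), by positivity, fun u g a b h => ?_⟩
  have ha := h.riesz_pos
  have hb := h.deriv_pos
  have hm := h.aestronglyMeasurable.enorm
  have hH := ENNReal.lintegral_mul_norm_pow_le (μ := (volume : Measure (Space d)))
    (hm.pow_const p₁) (hm.pow_const p₂) ht0 (sub_nonneg.2 ht1) (add_sub_cancel t 1)
  have hpt' : ∀ x, (‖u x‖ₑ ^ p₁) ^ t * (‖u x‖ₑ ^ p₂) ^ (1 - t) = ‖u x‖ₑ ^ p := fun x => by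
    rw [← ENNReal.rpow_mul, ← ENNReal.rpow_mul, ← ENNReal.rpow_add_of_nonneg, mul_comm p₁,
      mul_comm p₂, hpt]
    · positivity
    · exact mul_nonneg (by linarith) (sub_nonneg.2 ht1)
  simp only [hpt'] at hH
  refine hH.trans ?_
  have e1 : ∀ C x y θ : ℝ, 0 < C → (C * (a ^ x * b ^ y)) ^ θ = C ^ θ * (a ^ (θ * x) * b ^ (θ * y)) :=
    fun C x y θ hC => by
      rw [Real.mul_rpow hC.le (by positivity), Real.mul_rpow (by positivity) (by positivity),
        ← Real.rpow_mul ha.le, ← Real.rpow_mul hb.le, mul_comm x, mul_comm y]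
  calc _ ≤ ENNReal.ofReal (C₁ * (a ^ (p₁ - scalingExp d s α p₁) * b ^ scalingExp d s α p₁)) ^ t *
        ENNReal.ofReal (C₂ * (a ^ (p₂ - scalingExp d s α p₂) * b ^ scalingExp d s α p₂)) ^ (1 - t) :=
      mul_le_mul' (ENNReal.rpow_le_rpow (H₁ u g a b h) ht0)
        (ENNReal.rpow_le_rpow (H₂ u g a b h) (sub_nonneg.2 ht1))
    _ = _ := by
      rw [ENNReal.ofReal_rpow_of_pos (by positivity), ENNReal.ofReal_rpow_of_pos (by positivity),
        ← ENNReal.ofReal_mul (by positivity), e1 _ _ _ _ hC₁, e1 _ _ _ _ hC₂]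
      congr 1
      rw [← hτ, ← hpt]
      rw [show t * p₁ + (1 - t) * p₂ - (t * scalingExp d s α p₁ + (1 - t) * scalingExp d s α p₂) =
        t * (p₁ - scalingExp d s α p₁) + (1 - t) * (p₂ - scalingExp d s α p₂) by ring,
        Real.rpow_add ha, Real.rpow_add hb]
      ring

/-- Low-frequency growth bounds with the right homogeneity yield the inequality. -/
theorem radialIneq_of_lowFreq_le {s α σ K x y : ℝ} (hs : 0 < s) (hσ : 0 < σ) (hK : 0 < K)
    (hlow : ∀ (u g : Space d → ℂ) (a b : ℝ), RadialBounds d s α u g a b →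
      ∀ M : ℝ, 0 < M → ∀ z, ‖lowFreq g M z‖ₑ ≤ ENNReal.ofReal (K * (a ^ x * b ^ y) * M ^ σ))
    (hx : x * (2 * s / σ) = 2 + 2 * s / σ - scalingExp d s α (2 + 2 * s / σ))
    (hy : y * (2 * s / σ) + 2 = scalingExp d s α (2 + 2 * s / σ)) :
    RadialIneq d s α (2 + 2 * s / σ) := by
  refine ⟨(2 + 2 * s / σ) * (4 * ((2 * K) ^ (2 * s / σ) / (2 * s / σ))), by positivity,
    fun u g a b h => ?_⟩
  have ha := h.riesz_pos
  have hb := h.deriv_pos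
  refine (h.lintegral_rpow_le_of_lowFreq_le hs (by positivity) hσ (hlow u g a b h)).trans
    (ENNReal.ofReal_le_ofReal (le_of_eq ?_))
  rw [← hx, ← hy, Real.rpow_add hb, Real.rpow_mul ha.le, Real.rpow_mul hb.le, ← mul_assoc 2 K,
    Real.mul_rpow (x := 2 * K) (by positivity) (by positivity),
    Real.mul_rpow (x := a ^ x) (by positivity) (by positivity), ← Real.rpow_natCast b 2]
  push_cast
  ring

theorem radialIneq_riesz_endpoint {s α : ℝ} (hs : 0 < s) (hα : 0 < α) (hαd : α < d) :
    RadialIneq d s α (2 + 2 * s / (3 * d / 2 - α)) := by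
  obtain ⟨K, hK, hlow⟩ := exists_enorm_lowFreq_le_decayKer d (2 * d + 1)
  have hβ : 0 < 3 * (d : ℝ) / 2 - α := by linarith
  have hD : 0 < (d : ℝ) - α + s := by linarith
  have hτ : scalingExp d s α (2 + 2 * s / (3 * d / 2 - α)) = 2 := by
    rw [scalingExp, div_eq_iff hD.ne', mul_add, mul_div_cancel₀ _ hβ.ne']; ring
  have hv := unitBallVol_pos d
  refine radialIneq_of_lowFreq_le (x := 1) (y := 0) hs hβ (K := K * (√(unitBallVol d))⁻¹)
    (by positivity) ?_ (by rw [hτ]; ring) (by rw [hτ]; ring)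
  intro u g a b h M hM z
  refine (hlow h M hM z).trans ?_
  refine (mul_le_mul_right (lintegral_mul_decayKer_le_riesz hα h.riesz_pos.le h.riesz_le hM
    (N := ((2 * d + 1 : ℕ) : ℝ)) (by push_cast; linarith) z) _).trans ?_
  rw [← ENNReal.ofReal_mul hK.le]
  refine ENNReal.ofReal_le_ofReal (le_of_eq ?_)
  rw [Real.rpow_one, Real.rpow_zero]; ring

/-- Gain of integrability: from `L^q` to `L^(2 + 2 s q / d)`. -/
theorem RadialIneq.bootstrap {s α q : ℝ} (hd : d ≠ 0) (hs : 0 < s) (hαd : α < d)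
    (hq : 1 ≤ q) (h : RadialIneq d s α q) : RadialIneq d s α (2 + 2 * s / (d / q)) := by
  obtain ⟨K, hK, hlow⟩ := exists_enorm_lowFreq_le_decayKer d (2 * d + 1)
  obtain ⟨C, hC, H⟩ := h
  have hd0 : 0 < (d : ℝ) := by positivity
  have hq0 : 0 < q := by linarith
  have hD : 0 < (d : ℝ) - α + s := by linarith
  have hm := decayMass_nonneg d ((2 * d + 1 : ℕ) : ℝ)
  -- The `+ 1` makes the constant positive, `decayMass` being only known to be nonnegative.
  refine radialIneq_of_lowFreq_le (x := (q - scalingExp d s α q) / q)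
    (y := scalingExp d s α q / q) hs (by positivity)
    (K := K * (decayMass d ((2 * d + 1 : ℕ) : ℝ) ^ (1 - 1 / q) + 1) * C ^ (1 / q))
    (by positivity) ?_ ?_ ?_
  · intro u g a b h M hM z
    have ha := h.riesz_pos
    have hb := h.deriv_pos
    refine (hlow h M hM z).trans ?_
    have h1 := lintegral_mul_decayKer_le_lintegral_rpow h.aestronglyMeasurable hq hM
      (N := ((2 * d + 1 : ℕ) : ℝ)) (by push_cast; linarith) z
    have h2 : (∫⁻ y, ‖u y‖ₑ ^ q) ^ (1 / q) ≤ ENNReal.ofReal (C ^ (1 / q) *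
        (a ^ ((q - scalingExp d s α q) / q) * b ^ (scalingExp d s α q / q))) := by
      refine (ENNReal.rpow_le_rpow (H u g a b h) (by positivity)).trans ?_
      rw [ENNReal.ofReal_rpow_of_pos (by positivity)]
      refine ENNReal.ofReal_le_ofReal (le_of_eq ?_)
      rw [Real.mul_rpow hC.le (by positivity), Real.mul_rpow (by positivity) (by positivity),
        ← Real.rpow_mul ha.le, ← Real.rpow_mul hb.le, mul_one_div, mul_one_div]
    refine (mul_le_mul_right (h1.trans (mul_le_mul_right h2 _)) _).trans ?_
    rw [← ENNReal.ofReal_mul (by positivity), ← ENNReal.ofReal_mul hK.le]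
    refine ENNReal.ofReal_le_ofReal ?_
    set A := a ^ ((q - scalingExp d s α q) / q) * b ^ (scalingExp d s α q / q)
    set m := decayMass d ((2 * d + 1 : ℕ) : ℝ) ^ (1 - 1 / q)
    have hA : 0 < A := by positivity
    calc K * (m * M ^ (d / q) * (C ^ (1 / q) * A))
        = K * m * C ^ (1 / q) * A * M ^ (d / q) := by ring
      _ ≤ K * (m + 1) * C ^ (1 / q) * A * M ^ (d / q) := by gcongr; linarith
  · simp only [scalingExp]; field_simp; ring
  · simp only [scalingExp]; field_simp; ring

/-- Dilation reduces to the unit ball, where the singularity is integrable because `r < d`. -/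
theorem exists_lintegral_ball_norm_rpow_le {r : ℝ} (hd : d ≠ 0) (hr : r < d) :
    ∃ I : ℝ, 0 < I ∧ ∀ R : ℝ, 0 < R →
      ∫⁻ ξ in Metric.ball (0 : Space d) R, ENNReal.ofReal (‖ξ‖ ^ (-r)) ≤
        ENNReal.ofReal (R ^ (d - r) * I) := by
  set I₀ := ∫⁻ ξ in Metric.ball (0 : Space d) 1, ENNReal.ofReal (‖ξ‖ ^ (-r)) with hI₀
  have hfin : I₀ < ∞ := by
    have hm : Measurable fun ξ : Space d => ‖ξ‖ ^ (-r) := by fun_prop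
    have := integrableOn_ball_of_norm_le_rpow (μ := (volume : Measure (Space d)))
      (f := fun ξ : Space d => ‖ξ‖ ^ (-r)) (C := 1) (α := r) (r := 1)
      (by simpa using Nat.one_le_iff_ne_zero.2 hd) (by simpa using hr)
      (Filter.Eventually.of_forall fun x => by
        rw [one_mul, Real.norm_of_nonneg (by positivity)]) hm.aestronglyMeasurable
    simpa using! this.lintegral_lt_top
  refine ⟨I₀.toReal + 1, by positivity, fun R hR => ?_⟩
  set F : Space d → ℝ≥0∞ :=
    (Metric.ball (0 : Space d) R).indicator fun ξ => ENNReal.ofReal (‖ξ‖ ^ (-r)) with hF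
  have hFm : Measurable F := by
    refine Measurable.indicator ?_ measurableSet_ball
    fun_prop
  have h := lintegral_map (μ := (volume : Measure (Space d))) hFm (measurable_const_smul R)
  rw [Measure.map_addHaar_smul (volume : Measure (Space d)) hR.ne', lintegral_smul_measure,
    finrank_euclideanSpace_fin, abs_of_pos (by positivity), smul_eq_mul] at h
  have h2 : ∫⁻ η : Space d, F (R • η) = ENNReal.ofReal (R ^ (-r)) * I₀ := by
    rw [hI₀, ← lintegral_indicator measurableSet_ball, ← lintegral_const_mul' _ _
      ENNReal.ofReal_ne_top]
    refine lintegral_congr fun η => ?_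
    have hiff : R • η ∈ Metric.ball (0 : Space d) R ↔ η ∈ Metric.ball (0 : Space d) 1 := by
      rw [mem_ball_zero_iff, mem_ball_zero_iff, norm_smul, Real.norm_of_nonneg hR.le]
      constructor <;> intro h <;> nlinarith
    by_cases hη : η ∈ Metric.ball (0 : Space d) 1
    · rw [hF, Set.indicator_of_mem (hiff.2 hη), Set.indicator_of_mem hη,
        ← ENNReal.ofReal_mul (by positivity), norm_smul, Real.norm_of_nonneg hR.le,
        Real.mul_rpow hR.le (norm_nonneg _)]
    · rw [hF, Set.indicator_of_notMem (fun hh => hη (hiff.1 hh)), Set.indicator_of_notMem hη,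
        mul_zero]
  rw [← lintegral_indicator measurableSet_ball]
  have h3 : ∫⁻ ξ, F ξ = ENNReal.ofReal (R ^ d) * (ENNReal.ofReal (R ^ (-r)) * I₀) := by
    rw [← h2, ← h, ← mul_assoc, ← ENNReal.ofReal_mul (by positivity),
      mul_inv_cancel₀ (by positivity), ENNReal.ofReal_one, one_mul]
  refine h3.le.trans ?_
  rw [← mul_assoc, ← ENNReal.ofReal_mul (by positivity), ← ENNReal.ofReal_toReal hfin.ne,
    ← ENNReal.ofReal_mul (by positivity), ← Real.rpow_natCast, ← Real.rpow_add hR,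
    ENNReal.toReal_ofReal ENNReal.toReal_nonneg, ← sub_eq_add_neg]
  refine ENNReal.ofReal_le_ofReal ?_
  gcongr
  linarith

/-- Cauchy–Schwarz for `‖g‖ = (‖ξ‖ ^ s ‖g‖) * ‖ξ‖ ^ (-s)` on the ball of radius `2M` gives a
low-frequency bound with `σ = d/2 - s`, free of `a`. The exponent is `2d/(d - 2s)`. -/
theorem radialIneq_sobolev_endpoint {s α : ℝ} (hd : d ≠ 0) (hs : 0 < s) (hsd : s < d / 2)
    (hαd : α < d) : RadialIneq d s α (2 + 2 * s / (d / 2 - s)) := by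
  obtain ⟨I, hI, hball⟩ := exists_lintegral_ball_norm_rpow_le (d := d) (r := 2 * s) hd (by linarith)
  have hσ : 0 < (d : ℝ) / 2 - s := by linarith
  have hD : 0 < (d : ℝ) - α + s := by linarith
  have hp : (2 + 2 * s / (d / 2 - s)) * ((d : ℝ) / 2 - s) = d := by
    rw [add_mul, div_mul_cancel₀ _ hσ.ne']; ring
  have hτ : scalingExp d s α (2 + 2 * s / (d / 2 - s)) = 2 + 2 * s / (d / 2 - s) := by
    rw [scalingExp, div_eq_iff hD.ne']
    linear_combination hp
  refine radialIneq_of_lowFreq_le (x := 0) (y := 1) hs hσ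
    (K := 2 ^ (d / 2 - s) * √I) (by positivity) ?_ (by rw [hτ]; ring) (by rw [hτ]; ring)
  intro u g a b h M hM z
  have hb := h.deriv_pos
  refine (enorm_lowFreq_le_setLIntegral g hM z).trans ?_
  have hk : Measurable fun ξ : Space d => ENNReal.ofReal (‖ξ‖ ^ (-(2 * s))) := by fun_prop
  have hg := h.aestronglyMeasurable_fourier.enorm
  have hH := ENNReal.lintegral_mul_norm_pow_le
    (μ := (volume : Measure (Space d)).restrict (Metric.ball 0 (2 * M)))
    (f := fun ξ => ‖ξ‖ₑ ^ (2 * s) * ‖g ξ‖ₑ ^ 2) (g := fun ξ => ENNReal.ofReal (‖ξ‖ ^ (-(2 * s))))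
    (p := 1 / 2) (q := 1 / 2)
    (((measurable_enorm.pow_const (2 * s)).aemeasurable.mul (hg.pow_const 2)).restrict)
    hk.aemeasurable (by norm_num) (by norm_num) (by norm_num)
  have hnt : Nontrivial (Space d) :=
    Module.nontrivial_of_finrank_pos (R := ℝ) (by simpa using Nat.pos_of_ne_zero hd)
  have hae : ∀ᵐ ξ ∂(volume : Measure (Space d)).restrict (Metric.ball 0 (2 * M)),
      ‖g ξ‖ₑ = (‖ξ‖ₑ ^ (2 * s) * ‖g ξ‖ₑ ^ 2) ^ (1 / 2 : ℝ) *
        ENNReal.ofReal (‖ξ‖ ^ (-(2 * s))) ^ (1 / 2 : ℝ) := by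
    refine ae_restrict_of_ae ?_
    filter_upwards [Measure.ae_ne volume (0 : Space d)] with ξ hξ
    have hξ0 : 0 < ‖ξ‖ := norm_pos_iff.2 hξ
    rw [← ENNReal.mul_rpow_of_nonneg _ _ (by norm_num), mul_right_comm, ← ofReal_norm ξ,
      ENNReal.ofReal_rpow_of_pos hξ0, ← ENNReal.ofReal_mul (by positivity), ← Real.rpow_add hξ0,
      add_neg_cancel, Real.rpow_zero, ENNReal.ofReal_one, one_mul, ← ENNReal.rpow_natCast,
      ← ENNReal.rpow_mul]
    norm_num
  rw [lintegral_congr_ae hae]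
  refine hH.trans ?_
  calc _ ≤ ENNReal.ofReal (b ^ 2) ^ (1 / 2 : ℝ) *
        ENNReal.ofReal ((2 * M) ^ (d - 2 * s) * I) ^ (1 / 2 : ℝ) :=
      mul_le_mul' (ENNReal.rpow_le_rpow ((setLIntegral_le_lintegral _ _).trans h.deriv_le)
        (by norm_num)) (ENNReal.rpow_le_rpow (hball _ (by positivity)) (by norm_num))
    _ = _ := by
      rw [ENNReal.ofReal_rpow_of_pos (by positivity), ENNReal.ofReal_rpow_of_pos (by positivity),
        ← ENNReal.ofReal_mul (by positivity), Real.mul_rpow (by positivity) hI.le,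
        ← Real.rpow_mul (by positivity), Real.mul_rpow two_pos.le hM.le,
        ← Real.sqrt_eq_rpow, ← Real.sqrt_eq_rpow, Real.sqrt_sq hb.le, Real.rpow_zero,
        Real.rpow_one]
      have : ((d : ℝ) - 2 * s) * (1 / 2) = d / 2 - s := by ring
      rw [this]
      congr 1; ring

/-- When `s ≥ d/2`, one bootstrap step sends `q` to `2 + 2sq/d ≥ q + 2`. -/
theorem exists_radialIneq_ge {s α : ℝ} (hd : d ≠ 0) (hs : 0 < s) (hα : 0 < α) (hαd : α < d)
    (hsd : (d : ℝ) / 2 ≤ s) (n : ℕ) : ∃ q : ℝ, 1 ≤ q ∧ (n : ℝ) ≤ q ∧ RadialIneq d s α q := by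
  induction n with
  | zero =>
    have hβ : 0 < 3 * (d : ℝ) / 2 - α := by linarith
    have : 0 < 2 * s / (3 * d / 2 - α) := by positivity
    exact ⟨_, by linarith, by push_cast; linarith, radialIneq_riesz_endpoint hs hα hαd⟩
  | succ n ih =>
    obtain ⟨q, hq1, hqn, hq⟩ := ih
    have hd0 : 0 < (d : ℝ) := by positivity
    have : q ≤ 2 * s / (d / q) := by
      rw [le_div_iff₀ (by positivity), mul_div_cancel₀ _ (by positivity)]; linarith
    exact ⟨_, by linarith, by push_cast; linarith, hq.bootstrap hd hs hαd hq1⟩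

end Inequalities

/-! ### Exponents between `pRad` and two, by dyadic shells -/

section SmallExponents

variable {d : ℕ}

/-- Below level `l` the power is compared with the first power; above it `x ≤ 2 * y`, and the power
is compared with the square. -/
theorem rpow_le_add_of_norm_le_half {p l x y : ℝ} (hp1 : 1 ≤ p) (hp2 : p ≤ 2) (hl : 0 < l)
    (hx : 0 ≤ x) (hxy : x ≤ y + l / 2) :
    x ^ p ≤ l ^ (p - 1) * x + 4 * l ^ (p - 2) * y ^ 2 := by
  rcases le_or_gt x l with h | h
  · have h1 : x ^ p ≤ l ^ (p - 1) * x := by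
      rcases hx.eq_or_lt with rfl | hx
      · rw [Real.zero_rpow (by linarith), mul_zero]
      · calc x ^ p = x ^ (p - 1) * x := by
              rw [← Real.rpow_add_one hx.ne']; congr 1; ring
          _ ≤ _ := by
            gcongr
    have : 0 ≤ 4 * l ^ (p - 2) * y ^ 2 := by positivity
    linarith
  · have hx0 : 0 < x := hl.trans h
    have h1 : x ^ p = x ^ (p - 2) * x ^ 2 := by
      rw [← Real.rpow_natCast, ← Real.rpow_add hx0]; congr 1; push_cast; ring
    have h2 : x ^ (p - 2) ≤ l ^ (p - 2) :=
      Real.rpow_le_rpow_of_nonpos hl h.le (by linarith)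
    have h3 : x ^ 2 ≤ 4 * y ^ 2 := by nlinarith
    have h4 : 0 ≤ l ^ (p - 1) * x := by positivity
    have h5 : x ^ (p - 2) * x ^ 2 ≤ l ^ (p - 2) * (4 * y ^ 2) := by gcongr
    linarith

/-- Local `Lᵖ` bound, `1 ≤ p ≤ 2`, from a bound on the low frequencies. -/
theorem RadialBounds.setLIntegral_rpow_le {s α : ℝ} {u g : Space d → ℂ} {a b : ℝ}
    (h : RadialBounds d s α u g a b) (hs : 0 ≤ s) {p l M : ℝ} (hp1 : 1 ≤ p) (hp2 : p ≤ 2)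
    (hl : 0 < l) (hM : 0 < M) {S : Set (Space d)} (hS : MeasurableSet S)
    (hlow : ∀ x ∈ S, ‖lowFreq g M x‖ₑ ≤ ENNReal.ofReal (l / 2)) {m : ℝ} (hm0 : 0 ≤ m)
    (hm : ∫⁻ x in S, ‖u x‖ₑ ≤ ENNReal.ofReal m) :
    ∫⁻ x in S, ‖u x‖ₑ ^ p ≤
      ENNReal.ofReal (l ^ (p - 1) * m + 4 * l ^ (p - 2) * (M ^ (-(2 * s)) * b ^ 2)) := by
  have hpt : ∀ x ∈ S, ‖u x‖ₑ ^ p ≤ ENNReal.ofReal (l ^ (p - 1)) * ‖u x‖ₑ +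
      ENNReal.ofReal (4 * l ^ (p - 2)) * ‖u x - lowFreq g M x‖ₑ ^ 2 := by
    intro x hx
    have h1 := hlow x hx
    rw [← ofReal_norm, ENNReal.ofReal_le_ofReal_iff (by positivity)] at h1
    have h2 : ‖u x‖ ≤ ‖u x - lowFreq g M x‖ + l / 2 := by
      have := norm_sub_norm_le (u x) (lowFreq g M x)
      linarith
    rw [← ofReal_norm, ← ofReal_norm, ← ENNReal.ofReal_pow (norm_nonneg _),
      ENNReal.ofReal_rpow_of_nonneg (norm_nonneg _) (by linarith),
      ← ENNReal.ofReal_mul (by positivity), ← ENNReal.ofReal_mul (by positivity),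
      ← ENNReal.ofReal_add (by positivity) (by positivity)]
    exact ENNReal.ofReal_le_ofReal (rpow_le_add_of_norm_le_half hp1 hp2 hl (norm_nonneg _) h2)
  refine (setLIntegral_mono' hS hpt).trans ?_
  rw [lintegral_add_left' (h.aestronglyMeasurable.enorm.restrict.const_mul _),
    lintegral_const_mul' _ _ ENNReal.ofReal_ne_top, lintegral_const_mul' _ _ ENNReal.ofReal_ne_top,
    ENNReal.ofReal_add (by positivity) (by positivity), ENNReal.ofReal_mul (q := m) (by positivity),
    ENNReal.ofReal_mul (q := M ^ (-(2 * s)) * b ^ 2) (by positivity)]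
  refine add_le_add (mul_le_mul_right hm _) (mul_le_mul_right ?_ _)
  exact (setLIntegral_le_lintegral _ _).trans (h.lintegral_sub_lowFreq_le_rpow hs hM)

theorem univ_subset_ball_union_shells {r : ℝ} (hr : 0 < r) :
    (Set.univ : Set (Space d)) ⊆ Metric.ball 0 r ∪
      ⋃ j : ℕ, Metric.ball 0 (2 * (2 ^ j * r)) \ Metric.ball 0 (2 ^ j * r) := by
  intro x _
  rcases lt_or_ge ‖x‖ r with h | h
  · exact Or.inl (by simpa using h)
  · obtain ⟨j, h1, h2⟩ := exists_nat_pow_near ((one_le_div hr).2 h) (one_lt_two (α := ℝ))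
    refine Or.inr (Set.mem_iUnion.2 ⟨j, ?_⟩)
    rw [le_div_iff₀ hr] at h1
    rw [div_lt_iff₀ hr, pow_succ] at h2
    simp only [Set.mem_sdiff, mem_ball_zero_iff, not_lt]
    exact ⟨by linarith, h1⟩

theorem lintegral_le_of_shells {f : Space d → ℝ≥0∞} {r A B ρ : ℝ} (hr : 0 < r) (hA : 0 ≤ A)
    (hB : 0 ≤ B) (hρ0 : 0 ≤ ρ) (hρ1 : ρ < 1)
    (hball : ∫⁻ x in Metric.ball 0 r, f x ≤ ENNReal.ofReal A)
    (hshell : ∀ j : ℕ, ∫⁻ x in Metric.ball 0 (2 * (2 ^ j * r)) \ Metric.ball 0 (2 ^ j * r), f x ≤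
      ENNReal.ofReal (B * ρ ^ j)) :
    ∫⁻ x, f x ≤ ENNReal.ofReal (A + B * (1 - ρ)⁻¹) := by
  rw [← setLIntegral_univ]
  refine (lintegral_mono_set (univ_subset_ball_union_shells hr)).trans
    ((lintegral_union_le _ _ _).trans ?_)
  have hρ : 0 < 1 - ρ := by linarith
  rw [ENNReal.ofReal_add hA (by positivity)]
  refine add_le_add hball ((lintegral_iUnion_le _ _).trans ((ENNReal.tsum_le_tsum hshell).trans ?_))
  rw [← ENNReal.ofReal_tsum_of_nonneg (fun j => by positivity)
    ((summable_geometric_of_lt_one hρ0 hρ1).mul_left _), tsum_mul_left,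
    tsum_geometric_of_lt_one hρ0 hρ1]

theorem pRad_den_pos {s α : ℝ} (hd : 2 ≤ d) (hs : 0 < s) (hα : (d : ℝ) / 2 < α)
    (hα' : α < (d : ℝ) - 1 / 2) :
    0 < -(2 * s - 1) * (α - d / 2) + 2 * s * (d - 1) := by
  have hd' : (2 : ℝ) ≤ d := by exact_mod_cast hd
  nlinarith [mul_pos hs (sub_pos.2 hα')]

/-- Twice the denominator minus the numerator equals `2s(2d - 1 - 2α)`. -/
theorem pRad_lt_two {s α : ℝ} (hd : 2 ≤ d) (hs : 0 < s) (hα : (d : ℝ) / 2 < α)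
    (hα' : α < (d : ℝ) - 1 / 2) : pRad d s α < 2 := by
  rw [pRad, div_lt_iff₀ (pRad_den_pos hd hs hα hα')]
  nlinarith [mul_pos hs (sub_pos.2 hα')]

/-- The numerator exceeds the denominator by `(1 + 2s)(α - d/2)`. -/
theorem one_lt_pRad {s α : ℝ} (hd : 2 ≤ d) (hs : 0 < s) (hα : (d : ℝ) / 2 < α)
    (hα' : α < (d : ℝ) - 1 / 2) : 1 < pRad d s α := by
  rw [pRad, one_lt_div (pRad_den_pos hd hs hα hα')]
  nlinarith [mul_pos hs (sub_pos.2 hα)]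

/-- Together with `rpow_level_mul_tail`, this shows that the mass and tail terms carry the same
monomial in `a` and `m`, leaving only powers of `t` to compare. Writing every base as an exponential
makes the identity linear in logarithms. -/
theorem rpow_level_mul_mass {α p w c k a m t : ℝ} (hk : 0 < k) (ha : 0 < a) (hm : 0 < m)
    (ht : 0 < t) :
    (k * (a * m ^ (3 * d / 2 - α) * t ^ w)) ^ (p - 1) * (c * (t * m⁻¹) ^ (α - d / 2) * a) =
      k ^ (p - 1) * c * (a ^ p * m ^ ((3 * d / 2 - α) * p - d)) *
        t ^ (w * (p - 1) + (α - d / 2)) := by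
  obtain ⟨k, rfl⟩ : ∃ x, k = Real.exp x := ⟨_, (Real.exp_log hk).symm⟩
  obtain ⟨a, rfl⟩ : ∃ x, a = Real.exp x := ⟨_, (Real.exp_log ha).symm⟩
  obtain ⟨m, rfl⟩ : ∃ x, m = Real.exp x := ⟨_, (Real.exp_log hm).symm⟩
  obtain ⟨t, rfl⟩ : ∃ x, t = Real.exp x := ⟨_, (Real.exp_log ht).symm⟩
  rw [mul_assoc c, mul_left_comm _ c, mul_comm (_ ^ _) c, mul_assoc c, mul_assoc c]
  congr 1
  simp only [← Real.exp_mul, ← Real.exp_add, ← Real.exp_neg]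
  congr 1
  ring

theorem rpow_level_mul_tail {s α p w v k a m t : ℝ} (hk : 0 < k) (ha : 0 < a) (hm : 0 < m)
    (ht : 0 < t) :
    4 * (k * (a * m ^ (3 * d / 2 - α) * t ^ w)) ^ (p - 2) *
        ((m * t ^ v) ^ (-(2 * s)) * (a * m ^ (d - α + s)) ^ 2) =
      4 * k ^ (p - 2) * (a ^ p * m ^ ((3 * d / 2 - α) * p - d)) *
        t ^ (w * (p - 2) - 2 * s * v) := by
  obtain ⟨k, rfl⟩ : ∃ x, k = Real.exp x := ⟨_, (Real.exp_log hk).symm⟩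
  obtain ⟨a, rfl⟩ : ∃ x, a = Real.exp x := ⟨_, (Real.exp_log ha).symm⟩
  obtain ⟨m, rfl⟩ : ∃ x, m = Real.exp x := ⟨_, (Real.exp_log hm).symm⟩
  obtain ⟨t, rfl⟩ : ∃ x, t = Real.exp x := ⟨_, (Real.exp_log ht).symm⟩
  simp only [mul_assoc]
  congr 1
  simp only [← Real.exp_mul, ← Real.exp_add, ← Real.exp_nat_mul]
  congr 1
  push_cast
  ring

theorem radialIneq_of_pRad_lt {s α p : ℝ} (hd : 2 ≤ d) (hs : 0 < s) (hα : (d : ℝ) / 2 < α)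
    (hα' : α < (d : ℝ) - 1 / 2) (hp : pRad d s α < p) (hp2 : p ≤ 2) : RadialIneq d s α p := by
  have hd0 : d ≠ 0 := by omega
  have hd' : (2 : ℝ) ≤ d := by exact_mod_cast hd
  have hα0 : 0 < α := by linarith
  have hp1 : 1 < p := (one_lt_pRad hd hs hα hα').trans hp
  -- The shell estimate needs decay above `α + d`; `2d + 1` suffices since `α < d`.
  obtain ⟨K, hK, hlow⟩ := exists_enorm_lowFreq_le_decayKer d (2 * d + 1)
  have hNc : ((2 * d + 1 : ℕ) : ℝ) = 2 * d + 1 := by push_cast; ring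
  have hv := unitBallVol_pos d
  set D : ℝ := d - α + s with hDdef
  have hD : 0 < D := by rw [hDdef]; linarith
  set c₁ : ℝ := (√(unitBallVol d))⁻¹ with hc₁
  have hc₁0 : 0 < c₁ := by positivity
  set k₁ : ℝ := 2 * (K * c₁) with hk₁
  set k₂ : ℝ := 2 * (K * (2 ^ ((2 * d + 1 : ℕ) : ℝ) * 3 ^ α *
    decayMass d (((2 * d + 1 : ℕ) : ℝ) - α) * c₁ * (unitBallVol d)⁻¹) + 1) with hk₂
  set k₃ : ℝ := 2 ^ α * c₁ with hk₃
  have hdm := decayMass_nonneg d (((2 * d + 1 : ℕ) : ℝ) - α)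
  have hk₁0 : 0 < k₁ := by positivity
  have hk₂0 : 0 < k₂ := by positivity
  have hk₃0 : 0 < k₃ := by positivity
  -- exponents in the shell estimate
  set γ : ℝ := (2 * d - 1 - 2 * α) / (1 + 2 * s) with hγ
  have hγ0 : 0 ≤ γ := div_nonneg (by linarith) (by linarith)
  have hγe : γ * (1 + 2 * s) = 2 * d - 1 - 2 * α := by rw [hγ]; field_simp
  set e : ℝ := α - d / 2 - d + 1 + γ with he
  set κ : ℝ := e * (p - 1) + (α - d / 2) with hκ
  -- `γ` is the value for which mass and tail have the same exponent on the shell of radius `t / m`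
  -- cut at frequency `m * t ^ γ`.
  have heκ : e * (p - 2) - 2 * s * γ = κ := by
    rw [hκ, he]; linear_combination -hγe
  -- `κ * (1 + 2s)` is the numerator of `pRad` minus `p` times its denominator.
  have hκ0 : κ < 0 := by
    have h1 : e * (1 + 2 * s) = -(-(2 * s - 1) * (α - d / 2) + 2 * s * (d - 1)) := by
      rw [he]; linear_combination hγe
    have h2 := hp
    rw [pRad, div_lt_iff₀ (pRad_den_pos hd hs hα hα')] at h2
    have h3 : κ * (1 + 2 * s) < 0 := by
      have : κ * (1 + 2 * s) = e * (1 + 2 * s) * (p - 1) + (α - d / 2) * (1 + 2 * s) := by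
        rw [hκ]; ring
      rw [this, h1]; linarith
    by_contra hcon
    have : 0 ≤ κ * (1 + 2 * s) := mul_nonneg (not_lt.1 hcon) (by linarith)
    linarith
  set ρ : ℝ := 2 ^ κ with hρ
  have hρ0 : 0 < ρ := by positivity
  have hρ1 : ρ < 1 := Real.rpow_lt_one_of_one_lt_of_neg one_lt_two hκ0
  set c₂ : ℝ := k₁ ^ (p - 1) * k₃ + 4 * k₁ ^ (p - 2) with hc₂
  set c₃ : ℝ := k₂ ^ (p - 1) * (k₃ * 2 ^ (α - d / 2)) + 4 * k₂ ^ (p - 2) with hc₃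
  have hc₂0 : 0 < c₂ := by positivity
  have hc₃0 : 0 < c₃ := by positivity
  have hρ' : 0 < 1 - ρ := by linarith
  refine ⟨c₂ + c₃ * (1 - ρ)⁻¹, by positivity, fun u g a b h => ?_⟩
  have ha := h.riesz_pos
  have hb := h.deriv_pos
  -- the balanced frequency
  set m : ℝ := (b / a) ^ D⁻¹ with hmdef
  have hm : 0 < m := by positivity
  -- Eliminating `b` in favour of `m` turns every bound into a monomial in `a`, `m` and the dyadic
  -- radius.
  have hbm : b = a * m ^ D := by
    rw [hmdef, ← Real.rpow_mul (by positivity), inv_mul_cancel₀ hD.ne', Real.rpow_one]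
    field_simp
  set β : ℝ := 3 * d / 2 - α with hβ
  set Q : ℝ := a ^ p * m ^ (β * p - d) with hQ
  have hQ0 : 0 < Q := by positivity
  have hQeq : Q = a ^ (p - scalingExp d s α p) * b ^ scalingExp d s α p := by
    rw [hbm, Real.mul_rpow ha.le (by positivity), ← Real.rpow_mul hm.le, ← mul_assoc,
      ← Real.rpow_add ha, hQ, scalingExp, sub_add_cancel, ← hβ, ← hDdef,
      mul_div_cancel₀ _ hD.ne']
  rw [← hQeq, add_mul, mul_right_comm]
  -- Inside radius `1 / m` the bound that ignores symmetry suffices; the level is twice that bound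
  -- at frequency `m`.
  have hball : ∫⁻ x in Metric.ball 0 m⁻¹, ‖u x‖ₑ ^ p ≤ ENNReal.ofReal (c₂ * Q) := by
    refine (h.setLIntegral_rpow_le hs.le hp1.le hp2 (l := k₁ * (a * m ^ β)) (M := m)
      (m := k₃ * m⁻¹ ^ (α - d / 2) * a) (by positivity) hm measurableSet_ball (fun x _ => ?_)
      (by positivity) ?_).trans (ENNReal.ofReal_le_ofReal (le_of_eq ?_))
    · refine (hlow h m hm x).trans ((mul_le_mul_right (lintegral_mul_decayKer_le_riesz hα0 ha.le
        h.riesz_le hm (N := ((2 * d + 1 : ℕ) : ℝ)) (by linarith) x) _).trans ?_)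
      rw [← ENNReal.ofReal_mul hK.le]
      refine ENNReal.ofReal_le_ofReal (le_of_eq ?_)
      rw [hk₁]; ring
    · exact setLIntegral_ball_le_riesz hα0 ha.le h.riesz_le (inv_pos.2 hm)
    · have e1 := rpow_level_mul_mass (d := d) (α := α) (p := p) (w := 0) (c := k₃) (t := 1)
        hk₁0 ha hm one_pos
      have e2 := rpow_level_mul_tail (d := d) (α := α) (s := s) (p := p) (w := 0) (v := 0) (t := 1)
        hk₁0 ha hm one_pos
      simp only [Real.one_rpow, mul_one, one_mul] at e1 e2
      rw [hbm, e1, e2, hc₂]; ring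
  have hshell : ∀ j : ℕ,
      ∫⁻ x in Metric.ball 0 (2 * (2 ^ j * m⁻¹)) \ Metric.ball 0 (2 ^ j * m⁻¹), ‖u x‖ₑ ^ p ≤
        ENNReal.ofReal (c₃ * Q * ρ ^ j) := by
    intro j
    set t : ℝ := 2 ^ j with ht
    have ht1 : 1 ≤ t := one_le_pow₀ one_le_two
    have ht0 : 0 < t := by positivity
    have htρ : t ^ κ = ρ ^ j := by
      rw [ht, hρ, ← Real.rpow_natCast, ← Real.rpow_natCast, ← Real.rpow_mul two_pos.le,
        ← Real.rpow_mul two_pos.le, mul_comm]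
    refine (h.setLIntegral_rpow_le hs.le hp1.le hp2 (l := k₂ * (a * m ^ β * t ^ e))
      (M := m * t ^ γ) (m := k₃ * 2 ^ (α - d / 2) * (t * m⁻¹) ^ (α - d / 2) * a) (by positivity)
      (by positivity) (measurableSet_ball.diff measurableSet_ball) (fun x hx => ?_)
      (by positivity) ?_).trans (ENNReal.ofReal_le_ofReal (le_of_eq ?_))
    · have hxR : t * m⁻¹ ≤ ‖x‖ := by simpa using hx.2
      -- The shell average requires thickness at most the radius; `γ ≥ 0`, a consequence of `α < d -
      -- 1/2`, guarantees it.
      have hx1 : 1 ≤ m * t ^ γ * ‖x‖ := by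
        calc (1 : ℝ) ≤ t ^ γ * t :=
              one_le_mul_of_one_le_of_one_le (Real.one_le_rpow ht1 hγ0) ht1
          _ = m * t ^ γ * (t * m⁻¹) := by field_simp
          _ ≤ _ := by gcongr
      refine (hlow h _ (by positivity) x).trans ((mul_le_mul_right
        (lintegral_radial_mul_decayKer_le_riesz hd0 hα0 h.aestronglyMeasurable h.radial ha.le
          h.riesz_le (M := m * t ^ γ) (N := ((2 * d + 1 : ℕ) : ℝ)) (by positivity) (by linarith)
          hx1) _).trans ?_)
      rw [← ENNReal.ofReal_mul hK.le]
      refine ENNReal.ofReal_le_ofReal ?_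
      have hR : ‖x‖ ^ (α - d / 2 - d + 1) ≤ (t * m⁻¹) ^ (α - d / 2 - d + 1) :=
        Real.rpow_le_rpow_of_nonpos (by positivity) hxR (by linarith)
      have hRe : (t * m⁻¹) ^ (α - d / 2 - d + 1) * (m * t ^ γ) = m ^ β * t ^ e := by
        rw [Real.mul_rpow ht0.le (by positivity), Real.inv_rpow hm.le, ← Real.rpow_neg hm.le, he,
          Real.rpow_add ht0 _ γ, hβ,
          show 3 * (d : ℝ) / 2 - α = -(α - d / 2 - d + 1) + 1 by ring, Real.rpow_add_one hm.ne']
        ring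
      rw [← hc₁]
      set c := (2 : ℝ) ^ ((2 * d + 1 : ℕ) : ℝ) * 3 ^ α *
        decayMass d (((2 * d + 1 : ℕ) : ℝ) - α) * c₁ * (unitBallVol d)⁻¹ with hc
      have hc0 : 0 ≤ c := by positivity
      have hX : 0 < m ^ β * t ^ e * a := by positivity
      calc K * (c * ‖x‖ ^ (α - d / 2 - d + 1) * (m * t ^ γ) * a)
          ≤ K * (c * (t * m⁻¹) ^ (α - d / 2 - d + 1) * (m * t ^ γ) * a) := by gcongr
        _ = K * c * (m ^ β * t ^ e * a) := by rw [← hRe]; ring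
        _ ≤ k₂ * (a * m ^ β * t ^ e) / 2 := by rw [hk₂]; linarith
    · refine (lintegral_mono_set Set.sdiff_subset).trans ?_
      refine (setLIntegral_ball_le_riesz hα0 ha.le h.riesz_le (R := 2 * (t * m⁻¹))
        (by positivity)).trans (ENNReal.ofReal_le_ofReal (le_of_eq ?_))
      rw [Real.mul_rpow two_pos.le (by positivity), ← hc₁, ← hk₃]; ring
    · rw [hbm, rpow_level_mul_mass hk₂0 ha hm ht0, rpow_level_mul_tail hk₂0 ha hm ht0, ← hκ,
        show e * (p - 2) - 2 * s * γ = κ from heκ, htρ, hc₃]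
      ring
  refine (lintegral_le_of_shells (inv_pos.2 hm) (by positivity) (by positivity) hρ0.le hρ1
    hball hshell).trans (ENNReal.ofReal_le_ofReal (le_of_eq ?_))
  ring

end SmallExponents

/-! ### Assembly of the range, degenerate cases and passage to norms -/

section Conclusion

variable {d : ℕ}

theorem radialIneq_of_mem_range {s α p : ℝ} (hd : 2 ≤ d) (hs : 0 < s) (hα : (d : ℝ) / 2 < α)
    (hα' : α < (d : ℝ) - 1 / 2) (hp : pRad d s α < p)
    (hp' : s < (d : ℝ) / 2 → p ≤ 2 * d / (d - 2 * s)) : RadialIneq d s α p := by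
  have hd0 : d ≠ 0 := by omega
  have hd' : (2 : ℝ) ≤ d := by exact_mod_cast hd
  rcases le_or_gt p 2 with h2 | h2
  · exact radialIneq_of_pRad_lt hd hs hα hα' hp h2
  have hlo : RadialIneq d s α 2 :=
    radialIneq_of_pRad_lt hd hs hα hα' (pRad_lt_two hd hs hα hα') le_rfl
  rcases lt_or_ge s ((d : ℝ) / 2) with hsd | hsd
  · refine hlo.interpolate (radialIneq_sobolev_endpoint hd0 hs hsd (by linarith)) two_pos h2.le
      ((hp' hsd).trans (le_of_eq ?_))
    have h1 : (d : ℝ) - 2 * s ≠ 0 := by intro h; linarith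
    have h3 : (d : ℝ) / 2 - s ≠ 0 := by intro h; linarith
    field_simp
    ring
  · obtain ⟨n, hn⟩ := exists_nat_ge p
    obtain ⟨q, -, hnq, hq⟩ := exists_radialIneq_ge (α := α) hd0 hs (by linarith) (by linarith) hsd n
    exact hlo.interpolate hq two_pos h2.le (hn.trans hnq)

theorem IsGivenBy.unique {T T' : 𝓢'(Space d, ℂ)} {f f' : Space d → ℂ} (h : IsGivenBy T f)
    (h' : IsGivenBy T' f') (hff : f =ᵐ[volume] f') : T = T' := by
  ext φ
  rw [h.apply_eq, h'.apply_eq]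
  refine integral_congr_ae ?_
  filter_upwards [hff] with x hx
  rw [hx]

/-- Makes the norm of `D^s u` independent of the representative, so that membership in the Sobolev
space transfers square integrability to any given `v`. -/
theorem IsFracDeriv.ae_unique {s : ℝ} {u v v' : Space d → ℂ} (h : IsFracDeriv s u v)
    (h' : IsFracDeriv s u v') : v =ᵐ[volume] v' := by
  obtain ⟨U, V, g, hU, hV, hg, hVg⟩ := h
  obtain ⟨U', V', g', hU', hV', hg', hVg'⟩ := h'
  obtain rfl := hU.unique hU' .rfl
  have hFV : 𝓕 V = 𝓕 V' := hVg.unique hVg' (by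
    filter_upwards [hg.ae_eq hg'] with x hx
    rw [hx])
  have hVV : V = V' := by
    rw [← FourierTransform.fourierInv_fourier_eq (F := 𝓢'(Space d, ℂ)) V, hFV,
      FourierTransform.fourierInv_fourier_eq]
  subst hVV
  exact hV.ae_eq hV'

theorem ae_eq_zero_of_riesz_eq_zero {α : ℝ} (hα : 0 < α) {u : Space d → ℂ}
    (hu : AEStronglyMeasurable u) (h : eLpNorm (rieszConv α u) 2 volume = 0) :
    u =ᵐ[volume] 0 := by
  have h1 : ∀ n : ℕ, ∀ᵐ x, x ∈ Metric.ball (0 : Space d) (n + 1) → u x = 0 := by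
    intro n
    have h2 := setLIntegral_ball_le_riesz (u := u) (a := 0) (R := n + 1) hα le_rfl
      (by rw [h]; exact zero_le) (by positivity)
    rw [mul_zero, ENNReal.ofReal_zero, nonpos_iff_eq_zero,
      lintegral_eq_zero_iff' hu.enorm.restrict] at h2
    rw [← ae_restrict_iff' measurableSet_ball]
    filter_upwards [h2] with x hx
    simpa using hx
  filter_upwards [ae_all_iff.2 h1] with x hx
  obtain ⟨n, hn⟩ := exists_nat_ge ‖x‖
  exact hx n (by rw [mem_ball_zero_iff]; linarith)

theorem RadialIneq.eLpNorm_le {s α p : ℝ} (hd : d ≠ 0) (hα : 0 < α) (hp : 0 < p)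
    (h : RadialIneq d s α p) :
    ∃ C : ℝ≥0, ∀ u v : Space d → ℂ, MemX s α u → IsFracDeriv s u v →
      eLpNorm u (ENNReal.ofReal p) < ∞ ∧ eLpNorm u (ENNReal.ofReal p) ≤
        C * eLpNorm (rieszConv α u) 2 ^ (1 - scalingExp d s α p / p) *
          eLpNorm v 2 ^ (scalingExp d s α p / p) := by
  obtain ⟨C, hC, H⟩ := h
  refine ⟨Real.toNNReal (C ^ (1 / p)), fun u v hu huv => ?_⟩
  have hvL : MemLp v 2 := by
    obtain ⟨v', huv', hv'⟩ := hu.memHomSobolev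
    exact (memLp_congr_ae (huv.ae_unique huv')).2 hv'
  -- `RadialBounds` asks for positive `a` and `b`; if either norm vanishes, then `u` vanishes almost
  -- everywhere.
  have hzero : u =ᵐ[volume] 0 → eLpNorm u (ENNReal.ofReal p) < ∞ ∧
      eLpNorm u (ENNReal.ofReal p) ≤ Real.toNNReal (C ^ (1 / p)) *
        eLpNorm (rieszConv α u) 2 ^ (1 - scalingExp d s α p / p) *
          eLpNorm v 2 ^ (scalingExp d s α p / p) := fun h0 => by
    have : eLpNorm u (ENNReal.ofReal p) = 0 := by
      rw [eLpNorm_congr_ae h0]; exact eLpNorm_zero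
    rw [this]
    exact ⟨ENNReal.zero_lt_top, zero_le⟩
  obtain ⟨U, V, g, hU, hV, hg, hVg⟩ := huv
  obtain ⟨hhL, hhv⟩ := hV.eLpNorm_fourier_eq hVg hvL
  have hnt : Nontrivial (Space d) :=
    Module.nontrivial_of_finrank_pos (R := ℝ) (by simpa using Nat.pos_of_ne_zero hd)
  rcases eq_or_ne (eLpNorm (rieszConv α u) 2 volume) 0 with hA | hA
  · exact hzero (ae_eq_zero_of_riesz_eq_zero hα hU.locallyIntegrable.aestronglyMeasurable hA)
  rcases eq_or_ne (eLpNorm v 2 volume) 0 with hB | hB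
  · refine hzero ?_
    rw [← hhv, eLpNorm_eq_zero_iff hhL.1 two_ne_zero] at hB
    have hg0 : ∀ᵐ ξ, g ξ = 0 := by
      filter_upwards [hB, Measure.ae_ne volume (0 : Space d)] with ξ h1 h2
      have : ‖ξ‖ ^ s ≠ 0 := (Real.rpow_pos_of_pos (norm_pos_iff.2 h2) s).ne'
      simpa [this] using h1
    refine ae_eq_of_forall_integral_schwartz_eq hU.locallyIntegrable
      (locallyIntegrable_const 0) fun φ => ?_
    rw [hU.integral_eq_fourierInv hg]
    refine Eq.trans (integral_congr_ae (g := fun _ => (0 : ℂ)) ?_) (by simp)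
    filter_upwards [hg0] with ξ hξ
    rw [hξ, mul_zero]
  set A := eLpNorm (rieszConv α u) 2 volume with hAdef
  set B := eLpNorm v 2 volume with hBdef
  have hAt : A ≠ ∞ := hu.riesz_lt_top.ne
  have hBt : B ≠ ∞ := hvL.2.ne
  have ha : 0 < A.toReal := ENNReal.toReal_pos hA hAt
  have hb : 0 < B.toReal := ENNReal.toReal_pos hB hBt
  have hdata : RadialBounds d s α u g A.toReal B.toReal := by
    refine ⟨⟨U, hU, hg⟩, hu.isRadial, ha, hb, ?_, ?_⟩
    · rw [ENNReal.ofReal_toReal hAt]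
    · rw [ENNReal.ofReal_pow hb.le, ENNReal.ofReal_toReal hBt, ← hhv]
      have hsq : eLpNorm (fun ξ : Space d => ((‖ξ‖ ^ s : ℝ) : ℂ) * g ξ) 2 volume ^ 2 =
          ∫⁻ ξ : Space d, ‖((‖ξ‖ ^ s : ℝ) : ℂ) * g ξ‖ₑ ^ 2 := by
        simpa using! eLpNorm_nnreal_pow_eq_lintegral
          (f := fun ξ : Space d => ((‖ξ‖ ^ s : ℝ) : ℂ) * g ξ) (μ := volume) (p := 2) two_ne_zero
      rw [hsq]
      refine lintegral_mono_ae ?_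
      filter_upwards [Measure.ae_ne volume (0 : Space d)] with ξ hξ
      have hξ0 : 0 < ‖ξ‖ := norm_pos_iff.2 hξ
      rw [enorm_mul, mul_pow, ← ofReal_norm ξ, ENNReal.ofReal_rpow_of_pos hξ0,
        ← ofReal_norm ((‖ξ‖ ^ s : ℝ) : ℂ), Complex.norm_real,
        Real.norm_of_nonneg (by positivity), ← ENNReal.ofReal_pow (by positivity),
        ← Real.rpow_natCast, ← Real.rpow_mul hξ0.le, mul_comm s]
      norm_num
  have hmain := H u g _ _ hdata
  set τ := scalingExp d s α p
  have hbound : eLpNorm u (ENNReal.ofReal p) ≤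
      ENNReal.ofReal (C ^ (1 / p) * (A.toReal ^ (1 - τ / p) * B.toReal ^ (τ / p))) := by
    rw [eLpNorm_eq_lintegral_rpow_enorm_toReal (by simpa using hp) ENNReal.ofReal_ne_top,
      ENNReal.toReal_ofReal hp.le]
    refine (ENNReal.rpow_le_rpow hmain (by positivity)).trans ?_
    rw [ENNReal.ofReal_rpow_of_pos (by positivity)]
    refine ENNReal.ofReal_le_ofReal (le_of_eq ?_)
    rw [Real.mul_rpow hC.le (by positivity), Real.mul_rpow (by positivity) (by positivity),
      ← Real.rpow_mul ha.le, ← Real.rpow_mul hb.le, mul_one_div, mul_one_div, sub_div,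
      div_self hp.ne']
  refine ⟨hbound.trans_lt ENNReal.ofReal_lt_top, hbound.trans (le_of_eq ?_)⟩
  rw [ENNReal.ofReal_mul (by positivity), ENNReal.ofReal_mul (by positivity),
    ← ENNReal.ofReal_rpow_of_pos ha, ← ENNReal.ofReal_rpow_of_pos hb, ENNReal.ofReal_toReal hAt,
    ENNReal.ofReal_toReal hBt, ← mul_assoc]
  rfl

end Conclusion

theorem theorem4 (d : ℕ) (hd : 2 ≤ d) (s α : ℝ) (hs : 1 / 2 < s)
    (hα : (d : ℝ) / 2 < α) (hα' : α < (d : ℝ) - 1 / 2) :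
    pRad d s α < 2 ∧
    ∀ p : ℝ, pRad d s α < p → (s < (d : ℝ) / 2 → p ≤ 2 * d / (d - 2 * s)) →
      (∀ u : Space d → ℂ, MemX s α u → MemLp u (ENNReal.ofReal p)) ∧
      ∃ θ : ℝ, (d : ℝ) / p = (1 - θ) * ((d - α) + d / 2) + θ * (-s + d / 2) ∧
        ∃ C : ℝ≥0, ∀ u v : Space d → ℂ, MemX s α u → IsFracDeriv s u v →
          eLpNorm u (ENNReal.ofReal p) ≤
            C * eLpNorm (rieszConv α u) 2 ^ (1 - θ) * eLpNorm v 2 ^ θ := by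
  have hs0 : 0 < s := by linarith
  have hd' : (2 : ℝ) ≤ d := by exact_mod_cast hd
  refine ⟨pRad_lt_two hd hs0 hα hα', fun p hp hp' => ?_⟩
  have hp0 : 0 < p := by linarith [one_lt_pRad hd hs0 hα hα']
  obtain ⟨C, hC⟩ := (radialIneq_of_mem_range hd hs0 hα hα' hp hp').eLpNorm_le (by omega)
    (by linarith) hp0
  -- `scalingExp` is the exponent of `b` in the bound for the `p`-th power of the norm, hence `p *
  -- θ`.
  refine ⟨fun u hu => ?_, scalingExp d s α p / p, ?_, C, fun u v hu huv => (hC u v hu huv).2⟩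
  · obtain ⟨v, huv, -⟩ := hu.memHomSobolev
    refine ⟨?_, (hC u v hu huv).1⟩
    obtain ⟨U, V, g, hU, -⟩ := huv
    exact hU.locallyIntegrable.aestronglyMeasurable
  · have hD : (d : ℝ) - α + s ≠ 0 := by intro h; linarith
    have h1 : scalingExp d s α p * (d - α + s) = (3 * d / 2 - α) * p - d := by
      rw [scalingExp, div_mul_cancel₀ _ hD]
    rw [div_eq_iff hp0.ne']
    field_simp
    linear_combination 2 * h1
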